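/- Call a finite simple graph $G$ \emph{$H$-induced-saturated} if $G$ contains no induced copy of $H$, but adding to $G$ any edge joining two distinct nonadjacent vertices, and likewise deleting from $G$ any edge of $G$, creates an induced copy of $H$. When an $H$-induced-saturated graph on $n$ vertices exists, let $\mathrm{sis}(n,H)$ denote the minimum number of edges of such a graph. Let $K_{1,3}$ be the claw, i.e. the star with three leaves. Theorem. Let $n \ge 9$ be an integer with $n \ne 14$ and $n \ne 17$. Then a $K_{1,3}$-induced-saturated graph on $n$ vertices exists, and - if $n \equiv 0 \pmod 3$, then $\mathrm{sis}(n,K_{1,3}) = 2n$; - if $n \equiv 1 \pmod 3$, then $\mathrm{sis}(n,K_{1,3}) = 2n-2$; - if $n \equiv 2 \pmod 3$, then $2n \le \mathrm{sis}(n,K_{1,3}) \le 2n+2$. -/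

import Mathlib

/-- The claw `K_{1,3}`. -/
abbrev claw : SimpleGraph (Fin 1 ⊕ Fin 3) := completeBipartiteGraph (Fin 1) (Fin 3)

/-- `G` is `H`-induced-saturated: `G` has no induced copy of `H`, but adding any missing edge to
`G`, and likewise removing any edge from `G`, creates an induced copy of `H`. Here
`H.IsIndContained G'` says that `H` is isomorphic to an induced subgraph of `G'`. -/
structure IsInducedSaturated {V W : Type*} (H : SimpleGraph W) (G : SimpleGraph V) : Prop where
  free : ¬ H.IsIndContained G
  add : ∀ u v : V, u ≠ v → ¬ G.Adj u v → H.IsIndContained (G ⊔ SimpleGraph.edge u v)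
  remove : ∀ u v : V, G.Adj u v → H.IsIndContained (G.deleteEdges {s(u, v)})

/-- `sis n H` is the minimum number of edges of an `H`-induced-saturated graph on `n` vertices.
(It is meaningful only if such a graph exists.) -/
noncomputable def sis {W : Type*} (n : ℕ) (H : SimpleGraph W) : ℕ :=
  sInf {m : ℕ | ∃ G : SimpleGraph (Fin n), IsInducedSaturated H G ∧ G.edgeSet.ncard = m}

/-! Saturation is a local condition. The graph is claw-free; every edge `uv` has a centre, meaning a
common neighbour `c` with a third leaf `w` adjacent to `c` but to neither `u` nor `v`; and of any
two nonadjacent vertices, one has two nonadjacent neighbours that the other does not see (`Sat`).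

Upper bounds. The line graph of a cubic bipartite graph on `2k` vertices is saturated, with `3k`
vertices and `6k` edges. Disjoint unions stay saturated as long as one summand has no vertex with a
clique neighbourhood, so an isolated vertex can be added at no cost. Residue 2 uses in addition a
special graph with 10 vertices and 24 edges.

Lower bound. The aim is average degree four. A degree-three vertex with non-clique neighbourhood
sees a path `x z y`; its hub `z` has degree at least five and serves only that one cubic vertex, so
`z` can pay it one unit (`Hub.unique`, `Sat.sum_weight_le`). Vertices with clique neighbourhoods are
pairwise adjacent, and heavy vertices nearby make up for their deficit. Without isolated vertices
this gives `2n` edges (`Sat.two_mul_card_le`).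

With an isolated vertex, all `m = n - 1` others have non-clique neighbourhoods and carry at least
`2m` edges. If they carry at most `2m + 1`, the degrees exceed four by at most two in total. A cubic
vertex would force three heavy vertices (`Hub.threeHeavy`), so all degrees are at least four; local
analysis then excludes larger degrees and leaves only two disjoint edges or a path as
neighbourhoods. Every vertex lies in exactly two odd triangles, so `2m` is three times their number
and `3` divides `m` (`Tight.three_dvd`). Otherwise there are at least `2m + 2 = 2n` edges. -/

namespace ClawSat

open SimpleGraph

/-! ### Local reformulation of induced saturation -/

section

variable {V : Type*}

/-- An induced claw with centre `c` and leaves `a`, `b`, `d`. -/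
def ClawAt (G : SimpleGraph V) (c a b d : V) : Prop :=
  G.Adj c a ∧ G.Adj c b ∧ G.Adj c d ∧ a ≠ b ∧ a ≠ d ∧ b ≠ d ∧
    ¬ G.Adj a b ∧ ¬ G.Adj a d ∧ ¬ G.Adj b d

/-- `u` has two nonadjacent neighbours, both nonadjacent to `v`. -/
def Spread (G : SimpleGraph V) (u v : V) : Prop :=
  ∃ a b, G.Adj u a ∧ G.Adj u b ∧ a ≠ b ∧ ¬ G.Adj a b ∧ ¬ G.Adj a v ∧ ¬ G.Adj b v

/-- Elementary reformulation of being claw-induced-saturated. -/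
structure Sat (G : SimpleGraph V) : Prop where
  free : ∀ c a b d, G.Adj c a → G.Adj c b → G.Adj c d → a ≠ b → a ≠ d → b ≠ d →
    ¬ G.Adj a b → ¬ G.Adj a d → G.Adj b d
  rem : ∀ u v, G.Adj u v → ∃ c w, G.Adj c u ∧ G.Adj c v ∧ G.Adj c w ∧ w ≠ u ∧ w ≠ v ∧
    ¬ G.Adj w u ∧ ¬ G.Adj w v
  add : ∀ u v, u ≠ v → ¬ G.Adj u v → Spread G u v ∨ Spread G v u

theorem claw_isIndContained_iff (G : SimpleGraph V) :
    claw.IsIndContained G ↔ ∃ c a b d, ClawAt G c a b d := by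
  constructor
  · rintro ⟨f⟩
    have hne : ∀ {x y}, x ≠ y → f x ≠ f y := fun h => f.injective.ne h
    refine ⟨f (.inl 0), f (.inr 0), f (.inr 1), f (.inr 2), ?_, ?_, ?_, hne ?_, hne ?_, hne ?_,
      ?_, ?_, ?_⟩ <;> simp [f.map_adj_iff]
  · rintro ⟨c, a, b, d, hca, hcb, hcd, hab, had, hbd, nab, nad, nbd⟩
    have h1 := hca.ne
    have h2 := hcb.ne
    have h3 := hcd.ne
    refine ⟨⟨⟨Sum.elim (fun _ => c) ![a, b, d], ?_⟩, ?_⟩⟩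
    · rintro (i | i) (j | j) h <;> fin_cases i <;> fin_cases j <;> simp_all
    · rintro (i | i) (j | j) <;> fin_cases i <;> fin_cases j <;> simp_all [G.adj_comm] <;>
        first
        | exact hca | exact hcb | exact hcd | exact nab | exact nad | exact nbd
        | exact fun h => nab h.symm

/-- A new claw must involve the changed pair. After deleting `uv`, both ends are leaves; after
adding `uv`, one end is the centre and the other a leaf, and the two remaining leaves witness
`Spread`. -/
theorem Sat.of_isInducedSaturated {G : SimpleGraph V} (h : IsInducedSaturated claw G) :
    Sat G := by
  have hf := h.free
  rw [claw_isIndContained_iff] at hf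
  refine ⟨?_, ?_, ?_⟩
  · intro c a b d h1 h2 h3 h4 h5 h6 h7 h8
    by_contra h9
    exact hf ⟨c, a, b, d, h1, h2, h3, h4, h5, h6, h7, h8, h9⟩
  · intro u v huv
    have := h.remove u v huv
    rw [claw_isIndContained_iff] at this
    obtain ⟨c, a, b, d, hca, hcb, hcd, hab, had, hbd, nab, nad, nbd⟩ := this
    simp only [deleteEdges_adj, Set.mem_singleton_iff, not_and, not_not] at hca hcb hcd nab nad nbd
    have key : ∀ {x y}, (G.Adj x y → s(x, y) = s(u, v)) → ¬ G.Adj x y ∨ (s(x, y) = s(u, v)) := by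
      intro x y h; tauto
    rcases key nab with k1 | k1
    · rcases key nad with k2 | k2
      · rcases key nbd with k3 | k3
        · exact absurd ⟨c, a, b, d, hca.1, hcb.1, hcd.1, hab, had, hbd, k1, k2, k3⟩ hf
        · refine ⟨c, a, ?_⟩
          rcases Sym2.eq_iff.1 k3 with ⟨rfl, rfl⟩ | ⟨rfl, rfl⟩
          · exact ⟨hcb.1, hcd.1, hca.1, hab, had, k1, k2⟩
          · exact ⟨hcd.1, hcb.1, hca.1, had, hab, k2, k1⟩
      · have k3 : ¬ G.Adj b d := by
          intro hh
          have := nbd hh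
          rw [← k2] at this
          rcases Sym2.eq_iff.1 this with ⟨rfl, -⟩ | ⟨rfl, rfl⟩
          · exact hab rfl
          · exact hbd rfl
        refine ⟨c, b, ?_⟩
        rcases Sym2.eq_iff.1 k2 with ⟨rfl, rfl⟩ | ⟨rfl, rfl⟩
        · exact ⟨hca.1, hcd.1, hcb.1, hab.symm, hbd, fun h => k1 h.symm, k3⟩
        · exact ⟨hcd.1, hca.1, hcb.1, hbd, hab.symm, k3, fun h => k1 h.symm⟩
    · have k2 : ¬ G.Adj a d := by
        intro hh
        have := nad hh
        rw [← k1] at this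
        rcases Sym2.eq_iff.1 this with ⟨-, rfl⟩ | ⟨rfl, rfl⟩
        · exact hbd rfl
        · exact had rfl
      have k3 : ¬ G.Adj b d := by
        intro hh
        have := nbd hh
        rw [← k1] at this
        rcases Sym2.eq_iff.1 this with ⟨rfl, -⟩ | ⟨-, rfl⟩
        · exact hab rfl
        · exact had rfl
      refine ⟨c, d, ?_⟩
      rcases Sym2.eq_iff.1 k1 with ⟨rfl, rfl⟩ | ⟨rfl, rfl⟩
      · exact ⟨hca.1, hcb.1, hcd.1, had.symm, hbd.symm, fun h => k2 h.symm, fun h => k3 h.symm⟩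
      · exact ⟨hcb.1, hca.1, hcd.1, hbd.symm, had.symm, fun h => k3 h.symm, fun h => k2 h.symm⟩
  · intro u v hne huv
    have := h.add u v hne huv
    rw [claw_isIndContained_iff] at this
    obtain ⟨c, a, b, d, hca, hcb, hcd, hab, had, hbd, nab, nad, nbd⟩ := this
    simp only [sup_adj, edge_adj, not_or] at hca hcb hcd nab nad nbd
    have key : ∀ {c a b d : V}, (a ≠ b) → (a ≠ d) → (b ≠ d) → (c = u ∧ a = v ∨ c = v ∧ a = u) →
      (G.Adj c b ∨ (c = u ∧ b = v ∨ c = v ∧ b = u) ∧ c ≠ b) →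
      (G.Adj c d ∨ (c = u ∧ d = v ∨ c = v ∧ d = u) ∧ c ≠ d) →
      ¬ G.Adj a b → ¬ G.Adj a d → ¬ G.Adj b d → Spread G u v ∨ Spread G v u := by
      intro c a b d hab had hbd h1 h2 h3 n1 n2 n3
      rcases h1 with ⟨rfl, rfl⟩ | ⟨rfl, rfl⟩
      · left
        refine ⟨b, d, ?_, ?_, hbd, n3, fun h => n1 h.symm, fun h => n2 h.symm⟩ <;> grind
      · right
        refine ⟨b, d, ?_, ?_, hbd, n3, fun h => n1 h.symm, fun h => n2 h.symm⟩ <;> grind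
    by_cases k1 : (c = u ∧ a = v ∨ c = v ∧ a = u)
    · exact key hab had hbd k1 hcb hcd nab.1 nad.1 nbd.1
    by_cases k2 : (c = u ∧ b = v ∨ c = v ∧ b = u)
    · exact key hab.symm hbd had k2 hca hcd (fun h => nab.1 h.symm) nbd.1 nad.1
    by_cases k3 : (c = u ∧ d = v ∨ c = v ∧ d = u)
    · exact key had.symm hbd.symm hab k3 hca hcb (fun h => nad.1 h.symm)
        (fun h => nbd.1 h.symm) nab.1
    · exact absurd ⟨c, a, b, d, hca.resolve_right (fun h => k1 h.1),
        hcb.resolve_right (fun h => k2 h.1), hcd.resolve_right (fun h => k3 h.1),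
        hab, had, hbd, nab.1, nad.1, nbd.1⟩ hf

theorem Sat.isInducedSaturated {G : SimpleGraph V} (h : Sat G) : IsInducedSaturated claw G := by
  refine ⟨?_, ?_, ?_⟩
  · rw [claw_isIndContained_iff]
    rintro ⟨c, a, b, d, h1, h2, h3, h4, h5, h6, h7, h8, h9⟩
    exact h9 (h.free c a b d h1 h2 h3 h4 h5 h6 h7 h8)
  · intro u v hne huv
    rw [claw_isIndContained_iff]
    rcases h.add u v hne huv with ⟨a, b, h1, h2, h3, h4, h5, h6⟩ | ⟨a, b, h1, h2, h3, h4, h5, h6⟩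
    · refine ⟨u, v, a, b, ?_⟩
      simp only [ClawAt, sup_adj, edge_adj]
      have := h1.ne; have := h2.ne
      have := G.adj_comm a v; have := G.adj_comm b v
      grind
    · refine ⟨v, u, a, b, ?_⟩
      simp only [ClawAt, sup_adj, edge_adj]
      have := h1.ne; have := h2.ne
      have := G.adj_comm a u; have := G.adj_comm b u; have := G.adj_comm v u
      grind
  · intro u v huv
    rw [claw_isIndContained_iff]
    obtain ⟨c, w, h1, h2, h3, h4, h5, h6, h7⟩ := h.rem u v huv
    refine ⟨c, u, v, w, ?_⟩
    simp only [ClawAt, deleteEdges_adj, Set.mem_singleton_iff, Sym2.eq_iff]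
    have := h1.ne; have := h2.ne; have := h3.ne; have := huv.ne
    have := G.adj_comm w u; have := G.adj_comm w v
    grind

end

/-! ### Constructions for the upper bounds -/

section

variable {V W : Type*}

theorem Sat.of_iso {G : SimpleGraph V} {H : SimpleGraph W} (f : G ≃g H) (h : Sat G) : Sat H := by
  have hs : ∀ u v, Spread G u v → Spread H (f u) (f v) := by
    rintro u v ⟨a, b, h1, h2, h3, h4, h5, h6⟩
    exact ⟨f a, f b, f.map_adj_iff.2 h1, f.map_adj_iff.2 h2, f.injective.ne h3,
      fun h => h4 (f.map_adj_iff.1 h), fun h => h5 (f.map_adj_iff.1 h),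
      fun h => h6 (f.map_adj_iff.1 h)⟩
  refine ⟨?_, ?_, ?_⟩
  · intro c a b d
    obtain ⟨c, rfl⟩ := f.surjective c
    obtain ⟨a, rfl⟩ := f.surjective a
    obtain ⟨b, rfl⟩ := f.surjective b
    obtain ⟨d, rfl⟩ := f.surjective d
    simpa [f.map_adj_iff, f.injective.ne_iff] using h.free c a b d
  · intro u v
    obtain ⟨u, rfl⟩ := f.surjective u
    obtain ⟨v, rfl⟩ := f.surjective v
    rw [f.map_adj_iff]
    intro huv
    obtain ⟨c, w, h1, h2, h3, h4, h5, h6, h7⟩ := h.rem u v huv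
    refine ⟨f c, f w, ?_⟩
    simpa [f.map_adj_iff, f.injective.eq_iff] using ⟨h1, h2, h3, h4, h5, h6, h7⟩
  · intro u v
    obtain ⟨u, rfl⟩ := f.surjective u
    obtain ⟨v, rfl⟩ := f.surjective v
    rw [f.map_adj_iff, f.injective.ne_iff]
    intro hne huv
    exact (h.add u v hne huv).imp (hs u v) (hs v u)

/-- The neighbourhood of `u` is not a clique. -/
def NonSimplicial (G : SimpleGraph V) (u : V) : Prop :=
  ∃ a b, G.Adj u a ∧ G.Adj u b ∧ a ≠ b ∧ ¬ G.Adj a b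

/-- Only pairs across the summands are new, and for them the end in `G` is always the claw centre.
Hence `H` is free to contain an isolated vertex. -/
theorem Sat.sum {G : SimpleGraph V} {H : SimpleGraph W} (hG : Sat G) (hH : Sat H)
    (hn : ∀ u, NonSimplicial G u) : Sat (G ⊕g H) := by
  refine ⟨?_, ?_, ?_⟩
  · rintro (c | c) (a | a) (b | b) (d | d) <;> simp
    · exact hG.free c a b d
    · exact hH.free c a b d
  · rintro (u | u) (v | v) huv
    · obtain ⟨c, w, h1, h2, h3, h4, h5, h6, h7⟩ := hG.rem u v (by simpa using huv)
      exact ⟨.inl c, .inl w, by simp [h1, h2, h3, h4, h5, h6, h7]⟩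
    · simp at huv
    · simp at huv
    · obtain ⟨c, w, h1, h2, h3, h4, h5, h6, h7⟩ := hH.rem u v (by simpa using huv)
      exact ⟨.inr c, .inr w, by simp [h1, h2, h3, h4, h5, h6, h7]⟩
  · have hl : ∀ u v, Spread G u v → Spread (G ⊕g H) (.inl u) (.inl v) := by
      rintro u v ⟨a, b, h1, h2, h3, h4, h5, h6⟩
      exact ⟨.inl a, .inl b, by simp [h1, h2, h3, h4, h5, h6]⟩
    have hr : ∀ u v, Spread H u v → Spread (G ⊕g H) (.inr u) (.inr v) := by
      rintro u v ⟨a, b, h1, h2, h3, h4, h5, h6⟩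
      exact ⟨.inr a, .inr b, by simp [h1, h2, h3, h4, h5, h6]⟩
    have hx : ∀ u v, Spread (G ⊕g H) (.inl u) (.inr v) := by
      intro u v
      obtain ⟨a, b, h1, h2, h3, h4⟩ := hn u
      exact ⟨.inl a, .inl b, by simp [h1, h2, h3, h4]⟩
    rintro (u | u) (v | v) hne huv
    · exact (hG.add u v (by simpa using hne) (by simpa using huv)).imp (hl u v) (hl v u)
    · exact .inl (hx u v)
    · exact .inr (hx v u)
    · exact (hH.add u v (by simpa using hne) (by simpa using huv)).imp (hr u v) (hr v u)

theorem sat_bot [Subsingleton V] : Sat (⊥ : SimpleGraph V) :=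
  ⟨by simp, by simp, fun u v h => absurd (Subsingleton.elim u v) h⟩

theorem ncard_edgeSet_sum [Finite V] [Finite W] (G : SimpleGraph V) (H : SimpleGraph W) :
    (G ⊕g H).edgeSet.ncard = G.edgeSet.ncard + H.edgeSet.ncard := by
  classical
  rw [← Nat.card_coe_set_eq, Nat.card_congr edgeSetSumEquiv, Nat.card_sum,
    Nat.card_coe_set_eq, Nat.card_coe_set_eq]

theorem ncard_edgeSet_iso {G : SimpleGraph V} {H : SimpleGraph W} (f : G ≃g H) :
    G.edgeSet.ncard = H.edgeSet.ncard := by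
  rw [← Nat.card_coe_set_eq, Nat.card_congr f.mapEdgeSet, Nat.card_coe_set_eq]

/-- The rook graph on a set of points with given rows and columns. -/
def rook {ι : Type*} (r c : V → ι) : SimpleGraph V where
  Adj p q := p ≠ q ∧ (r p = r q ∨ c p = c q)
  symm := ⟨fun _ _ h => ⟨h.1.symm, h.2.imp Eq.symm Eq.symm⟩⟩
  loopless := ⟨fun _ h => h.1 rfl⟩

/-- Points are the edges of a simple bipartite graph of minimum degree three, rows and columns its
vertices. The neighbours of a point lie on two lines, so among any three of them two are collinear.
An edge inside a row has as centre a third point of the row, with third leaf in the column of that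
point. For a nonadjacent pair `u`, `v`, the row of `u` has a point off the column of `v`, and its
column a point off the row of `v`. -/
theorem rook_sat {ι : Type*} {r c : V → ι} (inj : ∀ p q, r p = r q → c p = c q → p = q)
    (hr : ∀ p, ∃ a b, a ≠ p ∧ b ≠ p ∧ a ≠ b ∧ r a = r p ∧ r b = r p)
    (hc : ∀ p, ∃ a b, a ≠ p ∧ b ≠ p ∧ a ≠ b ∧ c a = c p ∧ c b = c p) : Sat (rook r c) := by
  have rem : ∀ {r c : V → ι}, (∀ p q, r p = r q → c p = c q → p = q) →
      (∀ p, ∃ a b, a ≠ p ∧ b ≠ p ∧ a ≠ b ∧ r a = r p ∧ r b = r p) →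
      (∀ p, ∃ a b, a ≠ p ∧ b ≠ p ∧ a ≠ b ∧ c a = c p ∧ c b = c p) →
      ∀ u v, u ≠ v → r u = r v → ∃ x w, (rook r c).Adj x u ∧ (rook r c).Adj x v ∧
        (rook r c).Adj x w ∧ w ≠ u ∧ w ≠ v ∧ ¬ (rook r c).Adj w u ∧ ¬ (rook r c).Adj w v := by
    intro r c inj hr hc u v huv h
    obtain ⟨x, hxu, hxv, hx⟩ : ∃ x, x ≠ u ∧ x ≠ v ∧ r x = r u := by
      obtain ⟨a, b, h1, h2, h3, h4, h5⟩ := hr u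
      by_cases hav : a = v
      · exact ⟨b, h2, hav ▸ h3.symm, h5⟩
      · exact ⟨a, h1, hav, h4⟩
    obtain ⟨w, -, hw, -, -, hwc, -⟩ := hc x
    have h1 := inj w x
    have h2 := inj x u
    have h3 := inj x v
    refine ⟨x, w, ?_⟩
    simp only [rook]
    grind
  refine ⟨?_, ?_, ?_⟩
  · rintro p a b d ⟨-, h1⟩ ⟨-, h2⟩ ⟨-, h3⟩ h4 h5 h6
    simp only [rook]
    grind
  · rintro u v ⟨hne, h | h⟩
    · exact rem inj hr hc u v hne h
    · have hcomm : rook c r = rook r c := by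
        ext p q; simp only [rook]; tauto
      have := rem (fun p q h1 h2 => inj p q h2 h1) hc hr u v hne h
      rwa [hcomm] at this
  · intro u v hne huv
    left
    obtain ⟨a, ha, har, hac⟩ : ∃ a, a ≠ u ∧ r a = r u ∧ c a ≠ c v := by
      obtain ⟨a, b, h1, h2, h3, h4, h5⟩ := hr u
      by_cases h : c a = c v
      · exact ⟨b, h2, h5, fun hb => h3 (inj a b (h4.trans h5.symm) (h.trans hb.symm))⟩
      · exact ⟨a, h1, h4, h⟩
    obtain ⟨b, hb, hbc, hbr⟩ : ∃ a, a ≠ u ∧ c a = c u ∧ r a ≠ r v := by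
      obtain ⟨a, b, h1, h2, h3, h4, h5⟩ := hc u
      by_cases h : r a = r v
      · exact ⟨b, h2, h5, fun hb => h3 (inj a b (h.trans hb.symm) (h4.trans h5.symm))⟩
      · exact ⟨a, h1, h4, h⟩
    have h1 := inj a u
    have h2 := inj b u
    refine ⟨a, b, ?_⟩
    simp only [rook] at huv ⊢
    grind

theorem rook_nonSimplicial {ι : Type*} {r c : V → ι}
    (inj : ∀ p q, r p = r q → c p = c q → p = q)
    (hr : ∀ p, ∃ a, a ≠ p ∧ r a = r p) (hc : ∀ p, ∃ a, a ≠ p ∧ c a = c p) (u : V) :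
    NonSimplicial (rook r c) u := by
  obtain ⟨a, ha, har⟩ := hr u
  obtain ⟨b, hb, hbc⟩ := hc u
  have h1 := inj a u
  have h2 := inj b u
  refine ⟨a, b, ?_⟩
  simp only [rook]
  grind

/-- The line graph of the bipartite circulant cubic graph on `2 * k` vertices. -/
def cubicLine (k : ℕ) : SimpleGraph (ZMod k × Fin 3) :=
  rook (fun p => p.1) (fun p => p.1 + (p.2.val : ZMod k))

theorem natCast_fin_three_injective {k : ℕ} (hk : 3 ≤ k) (i j : Fin 3)
    (h : (i.val : ZMod k) = j.val) : i = j := by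
  rw [ZMod.natCast_eq_natCast_iff', Nat.mod_eq_of_lt (by omega), Nat.mod_eq_of_lt (by omega)] at h
  exact Fin.ext h

theorem cubicLine_inj {k : ℕ} (hk : 3 ≤ k) (p q : ZMod k × Fin 3) (h1 : p.1 = q.1)
    (h2 : p.1 + (p.2.val : ZMod k) = q.1 + (q.2.val : ZMod k)) : p = q := by
  refine Prod.ext h1 (natCast_fin_three_injective hk _ _ ?_)
  rw [h1] at h2
  exact add_left_cancel h2

theorem fin_three_others (j : Fin 3) : j + 1 ≠ j ∧ j + 2 ≠ j ∧ j + 1 ≠ j + 2 ∧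
    ∀ i, i = j ∨ i = j + 1 ∨ i = j + 2 := by
  revert j; decide

theorem cubicLine_rows {k : ℕ} (p : ZMod k × Fin 3) :
    ∃ a b : ZMod k × Fin 3, a ≠ p ∧ b ≠ p ∧ a ≠ b ∧ a.1 = p.1 ∧ b.1 = p.1 := by
  obtain ⟨i, j⟩ := p
  obtain ⟨h1, h2, h3, -⟩ := fin_three_others j
  exact ⟨(i, j + 1), (i, j + 2), by simp [h1], by simp [h2], by simp [h3], rfl, rfl⟩

theorem cubicLine_cols {k : ℕ} (p : ZMod k × Fin 3) :
    ∃ a b : ZMod k × Fin 3, a ≠ p ∧ b ≠ p ∧ a ≠ b ∧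
      a.1 + (a.2.val : ZMod k) = p.1 + (p.2.val : ZMod k) ∧
      b.1 + (b.2.val : ZMod k) = p.1 + (p.2.val : ZMod k) := by
  obtain ⟨i, j⟩ := p
  obtain ⟨h1, h2, h3, -⟩ := fin_three_others j
  refine ⟨(i + j.val - (j + 1).val, j + 1), (i + j.val - (j + 2).val, j + 2), ?_, ?_, ?_, ?_, ?_⟩
  · intro h; exact h1 (congrArg Prod.snd h)
  · intro h; exact h2 (congrArg Prod.snd h)
  · intro h; exact h3 (congrArg Prod.snd h)
  · simp
  · simp

theorem cubicLine_sat {k : ℕ} (hk : 3 ≤ k) : Sat (cubicLine k) :=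
  rook_sat (cubicLine_inj hk) cubicLine_rows cubicLine_cols

theorem cubicLine_nonSimplicial {k : ℕ} (hk : 3 ≤ k) (u : ZMod k × Fin 3) :
    NonSimplicial (cubicLine k) u :=
  rook_nonSimplicial (cubicLine_inj hk)
    (fun p => let ⟨a, _, h1, _, _, h2, _⟩ := cubicLine_rows p; ⟨a, h1, h2⟩)
    (fun p => let ⟨a, _, h1, _, _, h2, _⟩ := cubicLine_cols p; ⟨a, h1, h2⟩) u

/-- Each point has two others in its row and two in its column. An upper bound is enough, because
the lower bound on `sis` supplies the other direction. -/
theorem cubicLine_ncard {k : ℕ} (hk : 3 ≤ k) : (cubicLine k).edgeSet.ncard ≤ 2 * (3 * k) := by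
  classical
  have : NeZero k := ⟨by omega⟩
  have hdeg : ∀ p, (cubicLine k).degree p ≤ 4 := by
    rintro ⟨i, j⟩
    have hsub : (cubicLine k).neighborFinset (i, j) ⊆
        {(i, j + 1), (i, j + 2), (i + j.val - (j + 1).val, j + 1),
          (i + j.val - (j + 2).val, j + 2)} := by
      rintro ⟨i', j'⟩ h
      rw [mem_neighborFinset] at h
      obtain ⟨hne, h | h⟩ := h
      · simp only at h
        subst h
        rcases (fin_three_others j).2.2.2 j' with rfl | rfl | rfl
        · exact absurd rfl hne
        · simp
        · simp
      · simp only at h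
        have : i' = i + j.val - j'.val := by rw [h]; ring
        subst this
        rcases (fin_three_others j).2.2.2 j' with rfl | rfl | rfl
        · exact absurd (by simp) hne
        · simp
        · simp
    exact (Finset.card_le_card hsub).trans Finset.card_le_four
  have h := (cubicLine k).sum_degrees_eq_twice_card_edges
  have h2 : ∑ v, (cubicLine k).degree v ≤ ∑ _v : ZMod k × Fin 3, 4 :=
    Finset.sum_le_sum fun v _ => hdeg v
  rw [h] at h2
  simp only [Finset.sum_const, Finset.card_univ, Fintype.card_prod, ZMod.card, Fintype.card_fin,
    smul_eq_mul] at h2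
  rw [← coe_edgeFinset, Set.ncard_coe_finset]
  omega

/-- Bit masks of the neighbourhoods of the vertices of `tenGraph`. -/
def tenMask (u : Fin 10) : ℕ :=
  [432, 732, 962, 626, 203, 777, 286, 535, 101, 174].getD u 0

/-- A saturated graph with ten vertices and twenty-four edges. -/
def tenGraph : SimpleGraph (Fin 10) where
  Adj u v := (tenMask u).testBit v = true
  symm := ⟨by decide +kernel⟩
  loopless := ⟨by decide +kernel⟩

instance : DecidableRel tenGraph.Adj :=
  fun u v => inferInstanceAs (Decidable ((tenMask u).testBit v = true))

set_option synthInstance.maxHeartbeats 400000 in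
set_option synthInstance.maxSize 2000 in
theorem tenGraph_sat : Sat tenGraph := by
  refine ⟨by decide +kernel, by decide +kernel, ?_⟩
  unfold Spread
  decide +kernel

theorem tenGraph_nonSimplicial : ∀ u, NonSimplicial tenGraph u := by
  unfold NonSimplicial
  decide +kernel

theorem tenGraph_ncard : tenGraph.edgeSet.ncard = 24 := by
  have h := tenGraph.sum_degrees_eq_twice_card_edges
  have h2 : ∑ v, tenGraph.degree v = 48 := by decide +kernel
  rw [← coe_edgeFinset, Set.ncard_coe_finset]
  omega

theorem exists_sat_fin {V : Type*} [Fintype V] {G : SimpleGraph V} (h : Sat G) {n e : ℕ}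
    (hV : Fintype.card V = n) (he : G.edgeSet.ncard ≤ e) :
    ∃ G : SimpleGraph (Fin n), Sat G ∧ G.edgeSet.ncard ≤ e := by
  subst hV
  exact ⟨_, h.of_iso (G.overFinIso rfl), (ncard_edgeSet_iso (G.overFinIso rfl)) ▸ he⟩

theorem exists_sat_mul_three {k : ℕ} (hk : 3 ≤ k) :
    ∃ G : SimpleGraph (Fin (3 * k)), Sat G ∧ G.edgeSet.ncard ≤ 2 * (3 * k) := by
  have : NeZero k := ⟨by omega⟩
  exact exists_sat_fin (cubicLine_sat hk) (by simp [mul_comm]) (cubicLine_ncard hk)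

theorem exists_sat_mul_three_add_one {k : ℕ} (hk : 3 ≤ k) :
    ∃ G : SimpleGraph (Fin (3 * k + 1)), Sat G ∧ G.edgeSet.ncard ≤ 2 * (3 * k) := by
  have : NeZero k := ⟨by omega⟩
  refine exists_sat_fin (V := (ZMod k × Fin 3) ⊕ Fin 1)
    ((cubicLine_sat hk).sum sat_bot (cubicLine_nonSimplicial hk)) (by simp [mul_comm]) ?_
  rw [ncard_edgeSet_sum]
  simpa using cubicLine_ncard hk

theorem exists_sat_eleven :
    ∃ G : SimpleGraph (Fin 11), Sat G ∧ G.edgeSet.ncard ≤ 24 := by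
  refine exists_sat_fin (V := Fin 10 ⊕ Fin 1)
    (tenGraph_sat.sum sat_bot tenGraph_nonSimplicial) (by simp) ?_
  rw [ncard_edgeSet_sum, tenGraph_ncard]
  simp

theorem exists_sat_mul_three_add_eleven {k : ℕ} (hk : 3 ≤ k) :
    ∃ G : SimpleGraph (Fin (3 * k + 11)), Sat G ∧ G.edgeSet.ncard ≤ 2 * (3 * k) + 24 := by
  have : NeZero k := ⟨by omega⟩
  obtain ⟨G, hG, he⟩ := exists_sat_eleven
  refine exists_sat_fin (V := (ZMod k × Fin 3) ⊕ Fin 11)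
    ((cubicLine_sat hk).sum hG (cubicLine_nonSimplicial hk)) (by simp [mul_comm]) ?_
  rw [ncard_edgeSet_sum]
  have := cubicLine_ncard hk
  omega

end

/-! ### Degree-three vertices with non-clique neighbourhood, and their hubs -/

section

variable {V : Type*} {G : SimpleGraph V} {v x z y : V}

/-- `v` has exactly the three neighbours `x`, `z`, `y`, which induce a path with middle `z`. -/
structure Hub (G : SimpleGraph V) (v x z y : V) : Prop where
  vx : G.Adj v x
  vz : G.Adj v z
  vy : G.Adj v y
  zx : G.Adj z x
  zy : G.Adj z y
  xy : ¬ G.Adj x y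
  ne : x ≠ y
  nbr : ∀ t, G.Adj v t → t = x ∨ t = z ∨ t = y

theorem Hub.symm {v x z y : V} (H : Hub G v x z y) : Hub G v y z x :=
  ⟨H.vy, H.vz, H.vx, H.zy, H.zx, fun h => H.xy h.symm, H.ne.symm,
    fun t ht => by have := H.nbr t ht; tauto⟩

theorem Hub.nonSimplicial {v x z y : V} (H : Hub G v x z y) : NonSimplicial G v :=
  ⟨x, y, H.vx, H.vy, H.ne, H.xy⟩

theorem Sat.exists_common (h : Sat G) {u v : V} (huv : G.Adj u v) :
    ∃ c, G.Adj c u ∧ G.Adj c v := by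
  obtain ⟨c, w, h1, h2, -⟩ := h.rem u v huv
  exact ⟨c, h1, h2⟩

/-- `q` is a neighbour of `z` outside the closed neighbourhood of `v`. -/
def Far (G : SimpleGraph V) (v z q : V) : Prop := G.Adj z q ∧ q ≠ v ∧ ¬ G.Adj q v

/-- The only common neighbour of `v` and `x` is `z`, so it is the centre for `vx`. The third leaf
`w` must see `y`, or `x`, `y`, `w` would be a claw at `z`. -/
theorem Hub.exists_far (h : Sat G) (H : Hub G v x z y) :
    ∃ w, Far G v z w ∧ ¬ G.Adj w x ∧ G.Adj w y := by
  obtain ⟨c, w, h1, h2, h3, h4, h5, h6, h7⟩ := h.rem v x H.vx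
  have hc : c = z := by
    rcases H.nbr c h1.symm with rfl | rfl | rfl
    · exact absurd rfl h2.ne
    · rfl
    · exact absurd h2.symm H.xy
  subst hc
  refine ⟨w, ⟨h3, h4, h6⟩, h7, ?_⟩
  exact (h.free c x y w H.zx H.zy h3 H.ne h5.symm (fun e => h6 (e ▸ H.vy.symm)) H.xy
    (fun e => h7 e.symm)).symm

theorem Far.adj (h : Sat G) (hvz : G.Adj v z) {p q : V} (hp : Far G v z p) (hq : Far G v z q)
    (hpq : p ≠ q) : G.Adj p q :=
  h.free z v p q hvz.symm hp.1 hq.1 hp.2.1.symm hq.2.1.symm hpq (fun e => hp.2.2 e.symm)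
    (fun e => hq.2.2 e.symm)

theorem Hub.far_adj_or (h : Sat G) (H : Hub G v x z y) {q : V} (hq : Far G v z q) :
    G.Adj q x ∨ G.Adj q y := by
  by_contra hc
  rw [not_or] at hc
  exact hc.2 (h.free z x y q H.zx H.zy hq.1 H.ne (fun e => hq.2.2 (e ▸ H.vx.symm))
    (fun e => hq.2.2 (e ▸ H.vy.symm)) H.xy (fun e => hc.1 e.symm)).symm

/-- The only nonadjacent pair among the neighbours of `v` is `x`, `y`, so these are the witnesses.
-/
theorem Hub.spread (H : Hub G v x z y) {q : V} (hs : Spread G v q) :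
    ¬ G.Adj q x ∧ ¬ G.Adj q y := by
  obtain ⟨a, b, h1, h2, h3, h4, h5, h6⟩ := hs
  have hzx := H.zx
  have hzy := H.zy
  rcases H.nbr a h1 with rfl | rfl | rfl <;> rcases H.nbr b h2 with rfl | rfl | rfl <;>
    simp_all [G.adj_comm]

theorem Hub.ne_far (H : Hub G v x z y) {q : V} (hq : Far G v z q) : q ≠ x ∧ q ≠ y ∧ q ≠ z :=
  ⟨fun e => hq.2.2 (e ▸ H.vx.symm), fun e => hq.2.2 (e ▸ H.vy.symm), hq.1.ne.symm⟩

/-- Since `q` sees `x` or `y`, adding `vq` creates a claw centred at `q`. Its two other leaves are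
nonadjacent: they do not both see `z`, as far vertices form a clique, and they do not both miss `z`,
as that would be a claw at `q`. -/
theorem Hub.exists_outer (h : Sat G) (H : Hub G v x z y) {q : V} (hq : Far G v z q) :
    ∃ a b, Far G v z a ∧ G.Adj q a ∧ G.Adj q b ∧ b ≠ z ∧ b ≠ v ∧ ¬ G.Adj b z ∧ ¬ G.Adj b v ∧
      a ≠ b ∧ ¬ G.Adj a b := by
  rcases h.add v q hq.2.1.symm (fun e => hq.2.2 e.symm) with hs | ⟨a, b, h1, h2, h3, h4, h5, h6⟩
  · have := H.spread hs
    have := H.far_adj_or h hq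
    tauto
  · have key : ∀ {a}, G.Adj q a → ¬ G.Adj a v → a ≠ v ∧ a ≠ z := by
      intro a h1 h5
      exact ⟨fun e => hq.2.2 (e ▸ h1), fun e => h5 (e ▸ H.vz.symm)⟩
    have ha := key h1 h5
    have hb := key h2 h6
    by_cases hza : G.Adj z a
    · have hzb : ¬ G.Adj b z := fun e =>
        h4 (Far.adj h H.vz ⟨hza, ha.1, h5⟩ ⟨e.symm, hb.1, h6⟩ h3)
      exact ⟨a, b, ⟨hza, ha.1, h5⟩, h1, h2, hb.2, hb.1, hzb, h6, h3, h4⟩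
    · have hzb : G.Adj z b := by
        by_contra hzb
        exact h4 (h.free q z a b hq.1.symm h1 h2 ha.2.symm hb.2.symm h3 hza hzb)
      exact ⟨b, a, ⟨hzb, hb.1, h6⟩, h2, h1, ha.2, ha.1, fun e => hza e.symm, h5, h3.symm,
        fun e => h4 e.symm⟩

/-- `z` is the middle neighbour of some vertex of degree three. -/
def IsHub (G : SimpleGraph V) (z : V) : Prop := ∃ v x y, Hub G v x z y

theorem IsHub.nonSimplicial (hv : IsHub G v) : NonSimplicial G v := by
  obtain ⟨u, x, y, H⟩ := hv
  exact ⟨x, y, H.zx, H.zy, H.ne, H.xy⟩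

variable [Fintype V] [DecidableRel G.Adj]

theorem length_le_degree {v : V} (l : List V) (hl : l.Nodup) (h : ∀ x ∈ l, G.Adj v x) :
    l.length ≤ G.degree v := by
  classical
  rw [← List.toFinset_card_of_nodup hl, ← card_neighborFinset_eq_degree]
  exact Finset.card_le_card fun x hx => by simpa using h x (by simpa using hx)

theorem mem_of_degree_le {v : V} (l : List V) (hl : l.Nodup) (h : ∀ x ∈ l, G.Adj v x)
    (hd : G.degree v ≤ l.length) {x : V} (hx : G.Adj v x) : x ∈ l := by
  by_contra hxl
  have := length_le_degree (G := G) (v := v) (x :: l) (List.nodup_cons.2 ⟨hxl, hl⟩)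
    (by simpa using ⟨hx, h⟩)
  simp at this
  omega

theorem Hub.degree_eq {v x z y : V} (H : Hub G v x z y) : G.degree v = 3 := by
  classical
  have h1 := H.zx.ne
  have h2 := H.zy.ne
  have h3 := H.ne
  have : G.neighborFinset v = {x, z, y} := by
    ext t
    simp only [mem_neighborFinset, Finset.mem_insert, Finset.mem_singleton]
    refine ⟨H.nbr t, ?_⟩
    rintro (rfl | rfl | rfl)
    exacts [H.vx, H.vz, H.vy]
  rw [← card_neighborFinset_eq_degree, this, Finset.card_eq_three]
  exact ⟨x, z, y, h1.symm, h3, h2, rfl⟩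

theorem Sat.three_le_degree (h : Sat G) {v : V} (hv : NonSimplicial G v) : 3 ≤ G.degree v := by
  obtain ⟨a, b, h1, h2, h3, h4⟩ := hv
  obtain ⟨c, h5, h6⟩ := h.exists_common h1
  have h7 := h6.ne
  have h8 : c ≠ b := fun e => h4 (e ▸ h6.symm)
  exact length_le_degree [a, b, c] (by grind) (by simp [h1, h2, h5.symm])

theorem Sat.exists_hub (h : Sat G) {v : V} (hv : NonSimplicial G v) (hd : G.degree v = 3) :
    ∃ x z y, Hub G v x z y := by
  obtain ⟨a, b, h1, h2, h3, h4⟩ := hv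
  obtain ⟨c, h5, h6⟩ := h.exists_common h1
  have h7 := h6.ne
  have h8 : c ≠ b := fun e => h4 (e ▸ h6.symm)
  have hN : ∀ {t}, G.Adj v t → t ∈ [a, c, b] :=
    mem_of_degree_le [a, c, b] (by grind) (by simp [h1, h2, h5.symm]) (by simp [hd])
  obtain ⟨c', h9, h10⟩ := h.exists_common h2
  have : c' = c := by
    have := hN h9.symm
    have h11 := h10.ne
    simp only [List.mem_cons, List.not_mem_nil, or_false] at this
    rcases this with rfl | rfl | rfl
    · exact absurd h10 h4
    · rfl
    · exact absurd rfl h11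
  subst this
  exact ⟨a, c', b, h1, h5.symm, h2, h6, h10, h4, h3, fun t ht => by simpa using hN ht⟩

/-- With only two far vertices, the centre for `zx` has to be `q`. Its third leaf `t` sees `w`,
whereas the outer neighbour `b` of `q` does not, so `z, x, w, b, t` are distinct neighbours of `q`.
-/
theorem Hub.five_le_of_side (h : Sat G) (H : Hub G v x z y) {q w : V} (hq : Far G v z q)
    (hw : Far G v z w) (hqw : q ≠ w) (hwx : ¬ G.Adj w x) (hqx : G.Adj q x)
    (hall : ∀ p, Far G v z p → p = q ∨ p = w) : 5 ≤ G.degree q := by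
  obtain ⟨c, t, h1, h2, h3, h4, h5, h6, h7⟩ := h.rem z x H.zx
  have hcv : c ≠ v := by
    rintro rfl
    rcases H.nbr t h3 with rfl | rfl | rfl
    · exact h5 rfl
    · exact h4 rfl
    · exact h6 H.zy.symm
  have hcf : Far G v z c := by
    refine ⟨h1.symm, hcv, fun e => ?_⟩
    rcases H.nbr c e.symm with rfl | rfl | rfl
    · exact h2.ne rfl
    · exact h1.ne rfl
    · exact H.xy h2.symm
  have hcq : c = q := by
    rcases hall c hcf with rfl | rfl
    · rfl
    · exact absurd h2 hwx
  subst hcq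
  have hadj := Far.adj h H.vz hq hw hqw
  have htw : G.Adj t w := h.free c x t w hqx h3 hadj h5.symm (H.ne_far hw).1.symm
    (fun e => h6 (e ▸ hw.1.symm)) (fun e => h7 e.symm) (fun e => hwx e.symm)
  obtain ⟨a, b, ha, hca, hcb, hbz, hbv, hbz', hbv', hab, hab'⟩ := H.exists_outer h hq
  have haw : a = w := (hall a ha).resolve_left hca.ne.symm
  subst haw
  have e1 : b ≠ t := fun e => hab' (e ▸ htw.symm)
  have e2 : b ≠ x := fun e => hbz' (e ▸ H.zx.symm)
  have e3 := H.ne_far hw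
  have e4 : t ≠ a := fun e => h6 (e ▸ hw.1.symm)
  have e5 := H.zx.ne
  exact length_le_degree [z, x, a, b, t] (by grind) (by simp [h1, h2, hca, hcb, h3])

theorem Hub.five_le_of_far (h : Sat G) (H : Hub G v x z y) {q : V} (hq : Far G v z q) :
    5 ≤ G.degree q := by
  -- Two further far vertices, together with `z`, a side vertex and an outer neighbour, already make
  -- five. Otherwise the far vertices are just the two from `exists_far`.
  by_cases hall : ∃ a b, Far G v z a ∧ Far G v z b ∧ a ≠ q ∧ b ≠ q ∧ a ≠ b
  · obtain ⟨a, b, ha, hb, haq, hbq, hab⟩ := hall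
    obtain ⟨-, o, -, -, h1, h2, h3, h4, -⟩ := H.exists_outer h hq
    have key : ∀ s, G.Adj v s → G.Adj z s → G.Adj q s → 5 ≤ G.degree q := by
      intro s hs hzs hqs
      have e1 : o ≠ a := fun e => h4 (e ▸ ha.1.symm)
      have e2 : o ≠ b := fun e => h4 (e ▸ hb.1.symm)
      have e3 : o ≠ s := fun e => h4 (e ▸ hzs.symm)
      have e4 : a ≠ s := fun e => ha.2.2 (e ▸ hs.symm)
      have e5 : b ≠ s := fun e => hb.2.2 (e ▸ hs.symm)
      have e6 := hzs.ne
      have e7 := ha.1.ne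
      have e8 := hb.1.ne
      have d1 := Far.adj h H.vz hq ha haq.symm
      have d2 := Far.adj h H.vz hq hb hbq.symm
      exact length_le_degree [z, s, a, b, o] (by grind) (by simp [hq.1.symm, hqs, d1, d2, h1])
    rcases H.far_adj_or h hq with h' | h'
    · exact key x H.vx H.zx h'
    · exact key y H.vy H.zy h'
  · obtain ⟨w, hw, hwx, hwy⟩ := H.exists_far h
    obtain ⟨w', hw', hwy', hwx'⟩ := H.symm.exists_far h
    have hne : w ≠ w' := fun e => hwx (e ▸ hwx')
    have hone : ∀ {s t}, Far G v z s → Far G v z t → s ≠ q → t ≠ q → s = t := by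
      intro s t hs ht hsq htq
      by_contra hst
      exact hall ⟨s, t, hs, ht, hsq, htq, hst⟩
    by_cases hqw : w = q
    · subst hqw
      exact H.symm.five_le_of_side h hw hw' hne hwy' hwy fun p hp => by
        by_cases hpw : p = w
        · exact .inl hpw
        · exact .inr (hone hp hw' hpw hne.symm)
    · have hq' : w' = q := by
        by_contra hc
        exact hne (hone hw hw' hqw hc)
      subst hq'
      exact H.five_le_of_side h hw' hw hne.symm hwx hwx' fun p hp => by
        by_cases hpw : p = w'
        · exact .inl hpw
        · exact .inr (hone hp hw hpw hne)

theorem Hub.five_le (h : Sat G) (H : Hub G v x z y) : 5 ≤ G.degree z := by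
  obtain ⟨w, hw, hwx, hwy⟩ := H.exists_far h
  obtain ⟨w', hw', hwy', hwx'⟩ := H.symm.exists_far h
  have hne : w ≠ w' := fun e => hwx (e ▸ hwx')
  have e1 := H.ne_far hw
  have e2 := H.ne_far hw'
  have e3 := hw.2.1
  have e4 := hw'.2.1
  have e5 := H.vx.ne
  have e6 := H.vy.ne
  have e7 := H.ne
  exact length_le_degree [v, x, y, w, w'] (by grind)
    (by simp [H.vz.symm, H.zx, H.zy, hw.1, hw'.1])

/-- If `v`, `z`, `w` were all the neighbours of `x`, then `x` would form a claw at `w` with the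
nonadjacent pair from `exists_outer`. -/
theorem Hub.four_le_side (h : Sat G) (H : Hub G v x z y) : 4 ≤ G.degree x := by
  obtain ⟨w, hw, hwy, hwx⟩ := H.symm.exists_far h
  have e1 := H.vz.ne
  have e2 := hw.2.1
  have e3 := hw.1.ne
  by_contra hd
  have hN : ∀ {t}, G.Adj x t → t ∈ [v, z, w] :=
    mem_of_degree_le [v, z, w] (by grind) (by simp [H.vx.symm, H.zx.symm, hwx.symm])
      (by simp; omega)
  obtain ⟨a, b, ha, hwa, hwb, hbz, hbv, hbz', hbv', hab, hab'⟩ := H.exists_outer h hw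
  have hxa : ¬ G.Adj x a := by
    intro e
    have := hN e
    have := ha.2.1
    have := ha.1.ne
    have := hwa.ne
    grind
  have hxb : ¬ G.Adj x b := by
    intro e
    have := hN e
    have := hwb.ne
    grind
  exact hab' (h.free w x a b hwx hwa hwb (H.ne_far ha).1.symm
    (fun e => hbz' (e ▸ H.zx.symm)) hab hxa hxb)

/-- A neighbour of the hub other than `v` is a side vertex or a far vertex. Consequently a hub pays
for one cubic vertex only. -/
theorem Hub.four_le_of_adj (h : Sat G) (H : Hub G v x z y) {u : V} (hu : G.Adj z u) :
    u = v ∨ 4 ≤ G.degree u := by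
  by_cases huv : u = v
  · exact .inl huv
  right
  by_cases ha : G.Adj u v
  · rcases H.nbr u ha.symm with rfl | rfl | rfl
    · exact H.four_le_side h
    · exact absurd rfl hu.ne
    · exact H.symm.four_le_side h
  · have := H.five_le_of_far h ⟨hu, huv, ha⟩
    omega

theorem Hub.unique (h : Sat G) (H : Hub G v x z y) {u : V} (hu : G.Adj z u)
    (hd : G.degree u ≤ 3) : u = v :=
  (H.four_le_of_adj h hu).resolve_right (by omega)

/-- By uniqueness `x` could be a hub only for `v`, but `x` does not see `y` and so is not the middle
of the path. -/
theorem Hub.not_isHub_side (h : Sat G) (H : Hub G v x z y) : ¬ IsHub G x := by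
  rintro ⟨v', x', y', H'⟩
  have hv := H'.unique h H.vx.symm H.degree_eq.le
  subst hv
  have h1 := H'.zx
  have h2 := H'.zy
  have h3 := H'.ne
  have h4 := H.xy
  rcases H.nbr x' H'.vx with rfl | rfl | rfl
  · exact h1.ne rfl
  · rcases H.nbr y' H'.vy with rfl | rfl | rfl
    · exact h2.ne rfl
    · exact h3 rfl
    · exact h4 h2
  · exact h4 h1

theorem IsHub.five_le (h : Sat G) (hz : IsHub G z) : 5 ≤ G.degree z := by
  obtain ⟨v, x, y, H⟩ := hz
  exact H.five_le h

end

/-! ### Discharging and heavy vertices -/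

section

variable {V : Type*} [Fintype V] {G : SimpleGraph V} [DecidableRel G.Adj] {v x z y : V}

open Classical in
/-- The excess of the degree over four, after each degree-three vertex with non-clique
neighbourhood has received one unit from its hub. -/
noncomputable def weight (G : SimpleGraph V) [DecidableRel G.Adj] (v : V) : ℤ :=
  (G.degree v : ℤ) - 4 + (if ∃ x z y, Hub G v x z y then 1 else 0) - (if IsHub G v then 1 else 0)

theorem le_weight_of_not_isHub (hv : ¬ IsHub G v) : (G.degree v : ℤ) - 4 ≤ weight G v := by
  unfold weight
  rw [if_neg hv]
  split_ifs <;> omega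

theorem le_weight : (G.degree v : ℤ) - 5 ≤ weight G v := by
  unfold weight
  split_ifs <;> omega

theorem Sat.weight_nonneg (h : Sat G) (hv : NonSimplicial G v) : 0 ≤ weight G v := by
  by_cases hh : IsHub G v
  · have := hh.five_le h
    have := le_weight (G := G) (v := v)
    omega
  · have h3 := h.three_le_degree hv
    by_cases hd : G.degree v = 3
    · have := h.exists_hub hv hd
      unfold weight
      rw [if_neg hh, if_pos this, hd]
      norm_num
    · have := le_weight_of_not_isHub hh
      omega

/-- Assigning a hub to each cubic vertex is injective by `Hub.unique`, so at most as many units are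
added as are subtracted. -/
theorem Sat.sum_weight_le (h : Sat G) (A : Finset V) (hA : ∀ z, IsHub G z → z ∈ A) :
    ∑ v ∈ A, weight G v ≤ ∑ v ∈ A, ((G.degree v : ℤ) - 4) := by
  classical
  have hcard : (A.filter fun v => ∃ x z y, Hub G v x z y).card ≤ (A.filter (IsHub G)).card := by
    have hex : ∀ v, ∃ z, (∃ x z y, Hub G v x z y) → ∃ x y, Hub G v x z y := by
      intro v
      by_cases hv : ∃ x z y, Hub G v x z y
      · obtain ⟨x, z, y, H⟩ := hv
        exact ⟨z, fun _ => ⟨x, y, H⟩⟩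
      · exact ⟨v, fun hc => absurd hc hv⟩
    choose f hf using hex
    refine Finset.card_le_card_of_injOn f ?_ ?_
    · intro v hv
      simp only [Finset.coe_filter, Set.mem_ofPred_eq] at hv ⊢
      obtain ⟨x, y, H⟩ := hf v hv.2
      exact ⟨hA _ ⟨v, x, y, H⟩, ⟨v, x, y, H⟩⟩
    · intro v hv v' hv' he
      simp only [Finset.coe_filter, Set.mem_ofPred_eq] at hv hv'
      obtain ⟨x, y, H⟩ := hf v hv.2
      obtain ⟨x', y', H'⟩ := hf v' hv'.2
      rw [← he] at H'
      exact H'.unique h H.vz.symm H.degree_eq.le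
  unfold weight
  rw [Finset.sum_sub_distrib, Finset.sum_add_distrib, Finset.sum_boole, Finset.sum_boole]
  have : ((A.filter fun v => ∃ x z y, Hub G v x z y).card : ℤ) ≤ (A.filter (IsHub G)).card := by
    exact_mod_cast hcard
  linarith

/-- There are three vertices of positive weight. -/
def ThreeHeavy (G : SimpleGraph V) [DecidableRel G.Adj] : Prop :=
  ∃ a b c, a ≠ b ∧ a ≠ c ∧ b ≠ c ∧ 1 ≤ weight G a ∧ 1 ≤ weight G b ∧ 1 ≤ weight G c

theorem one_le_weight (hd : 5 ≤ G.degree v) (hv : ¬ IsHub G v) : 1 ≤ weight G v := by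
  have := le_weight_of_not_isHub hv
  omega

/-- Let `w` be the hub of `v₂`. Then `y` is far for `v₂`, while `w'` is a side vertex of `v₂` and
far for `v`; both have degree at least five and are not hubs. The hub `z` gets degree six, which
leaves weight one after its payment. -/
theorem Hub.threeHeavy_of_isHub_far (h : Sat G) (H : Hub G v x z y) {w : V} (hw : Far G v z w)
    (hwh : IsHub G w) (hwy : G.Adj w y) : ThreeHeavy G := by
  obtain ⟨v₂, x₂, y₂, H₂⟩ := hwh
  have hd2 := H₂.degree_eq
  have hvv₂ : v ≠ v₂ := by
    rintro rfl
    exact hw.2.2 H₂.vz.symm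
  have hvv₂' : ¬ G.Adj v v₂ := by
    intro e
    have h1 := H.four_le_side h
    have h2 := H.five_le h
    have h3 := H.symm.four_le_side h
    rcases H.nbr v₂ e with rfl | rfl | rfl <;> omega
  have hzv₂ : ¬ G.Adj z v₂ := fun e => hvv₂ (H.unique h e hd2.le).symm
  have hyv₂ : ¬ G.Adj y v₂ := by
    rcases h.add v v₂ hvv₂ hvv₂' with hs | hs
    · exact fun e => (H.spread hs).2 e.symm
    · intro e
      have hs' := H₂.spread hs
      rcases H₂.nbr y e.symm with rfl | rfl | rfl
      · exact hs'.1 H.vy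
      · exact hwy.ne rfl
      · exact hs'.2 H.vy
  have hyf : Far G v₂ w y := ⟨hwy, fun e => hvv₂' (e ▸ H.vy), hyv₂⟩
  obtain ⟨w', hw', hwy', hwx'⟩ := H.symm.exists_far h
  have hww' : w ≠ w' := fun e => hwy' (e ▸ hwy)
  have hadj := Far.adj h H.vz hw hw' hww'
  have hw'v₂ : G.Adj w' v₂ := by
    by_contra hc
    have hf : Far G v₂ w w' := ⟨hadj, fun e => hzv₂ (e ▸ hw'.1), hc⟩
    exact hwy' (Far.adj h H₂.vz hf hyf (H.ne_far hw').2.1)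
  have hside : w' = x₂ ∨ w' = y₂ := by
    rcases H₂.nbr w' hw'v₂.symm with e | e | e
    · exact .inl e
    · exact absurd e.symm hww'
    · exact .inr e
  have hw'h : ¬ IsHub G w' := by
    rcases hside with rfl | rfl
    · exact H₂.not_isHub_side h
    · exact H₂.symm.not_isHub_side h
  have hz6 : 6 ≤ G.degree z := by
    obtain ⟨a, b, ha, hwa, hwb, hbz, hbv, hbz', hbv', hab, hab'⟩ := H.exists_outer h hw'
    -- The outer neighbour of `w'` is `v₂`. Since `w` sees `v₂` and `a` does not, `a` differs from
    -- `w` and is a sixth neighbour of `z`.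
    have hb : b = v₂ := by
      by_contra hb
      have h1 : G.Adj v₂ b := h.free w' z v₂ b hw'.1.symm hw'v₂ hwb
        (fun e => H.symm.five_le h |>.not_gt (by rw [e]; omega)) hbz.symm (Ne.symm hb) hzv₂
        (fun e => hbz' e.symm)
      have h2 := hwb.ne
      have h3 := H₂.xy
      rcases H₂.nbr b h1 with rfl | rfl | rfl
      · rcases hside with rfl | rfl
        · exact h2 rfl
        · exact h3 hwb.symm
      · exact hbz' hw.1.symm
      · rcases hside with rfl | rfl
        · exact h3 hwb
        · exact h2 rfl
    subst hb
    have h1 : a ≠ w := fun e => hab' (e ▸ H₂.vz.symm)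
    have h2 := hwa.ne
    have e1 := H.ne_far hw
    have e2 := H.ne_far hw'
    have e3 := H.ne_far ha
    have e4 := hw.2.1
    have e5 := hw'.2.1
    have e6 := ha.2.1
    have e7 := H.vx.ne
    have e8 := H.vy.ne
    have e9 := H.ne
    exact length_le_degree [v, x, y, w, w', a] (by grind)
      (by simp [H.vz.symm, H.zx, H.zy, hw.1, hw'.1, ha.1])
  refine ⟨y, w', z, (H.ne_far hw').2.1.symm, H.zy.ne.symm, (H.ne_far hw').2.2, ?_, ?_, ?_⟩
  · exact one_le_weight (H₂.five_le_of_far h hyf) (H.symm.not_isHub_side h)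
  · exact one_le_weight (H.five_le_of_far h hw') hw'h
  · have := le_weight (G := G) (v := z)
    omega

/-- Here the neighbours of `y` are `v`, `z`, `w`, `b`. The first two see `x`, and the last two are
adjacent to each other, so no witnesses remain. -/
theorem Hub.not_spread_side (h : Sat G) (H : Hub G v x z y) {w w' : V} (hw : Far G v z w)
    (hw' : Far G v z w') (hwy : G.Adj w y) (hwy' : ¬ G.Adj w' y)
    (hall : ∀ p, Far G v z p → p = w ∨ p = w') (hd : G.degree y ≤ 4) : ¬ Spread G y x := by
  obtain ⟨a, b, ha, hwa, hwb, hbz, hbv, hbz', hbv', hab, hab'⟩ := H.exists_outer h hw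
  have haw : a = w' := (hall a ha).resolve_left hwa.ne.symm
  subst haw
  have hby : b ≠ y := fun e => hbz' (e ▸ H.zy.symm)
  have hyb : G.Adj y b := h.free w a y b hwa hwy hwb (H.ne_far ha).2.1 hab hby.symm hwy' hab'
  have e1 := H.vz.ne
  have e2 := hw.2.1
  have e3 := hw.1.ne
  have e4 := hwb.ne
  have hN : ∀ {t}, G.Adj y t → t ∈ [v, z, w, b] :=
    mem_of_degree_le [v, z, w, b] (by grind) (by simp [H.vy.symm, H.zy.symm, hwy.symm, hyb])
      (by simpa using hd)
  rintro ⟨p, q, h1, h2, h3, h4, h5, h6⟩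
  have hp := hN h1
  have hq := hN h2
  have f1 := H.vx
  have f2 := H.zx
  have f3 := hwb.symm
  grind

/-- Far vertices that are not hubs are heavy, so three of them suffice. If there are only two, the
claw created by adding `xy` forces `x` or `y` to have degree five. -/
theorem Hub.threeHeavy (h : Sat G) (H : Hub G v x z y) : ThreeHeavy G := by
  by_cases hq : ∃ q, Far G v z q ∧ IsHub G q
  · obtain ⟨q, hq, hqh⟩ := hq
    rcases H.far_adj_or h hq with h1 | h1
    · exact H.symm.threeHeavy_of_isHub_far h hq hqh h1
    · exact H.threeHeavy_of_isHub_far h hq hqh h1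
  have hf : ∀ q, Far G v z q → 1 ≤ weight G q := fun q hqf =>
    one_le_weight (H.five_le_of_far h hqf) fun hc => hq ⟨q, hqf, hc⟩
  obtain ⟨w, hw, hwx, hwy⟩ := H.exists_far h
  obtain ⟨w', hw', hwy', hwx'⟩ := H.symm.exists_far h
  have hne : w ≠ w' := fun e => hwx (e ▸ hwx')
  by_cases hall : ∀ p, Far G v z p → p = w ∨ p = w'
  · have e1 := H.ne_far hw
    have e2 := H.ne_far hw'
    by_cases hx : 5 ≤ G.degree x
    · exact ⟨w, w', x, hne, e1.1, e2.1, hf w hw, hf w' hw', one_le_weight hx (H.not_isHub_side h)⟩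
    by_cases hy : 5 ≤ G.degree y
    · exact ⟨w, w', y, hne, e1.2.1, e2.2.1, hf w hw, hf w' hw',
        one_le_weight hy (H.symm.not_isHub_side h)⟩
    have s1 := H.not_spread_side h hw hw' hwy hwy' hall (by omega)
    have s2 := H.symm.not_spread_side h hw' hw hwx' hwx (fun p hp => (hall p hp).symm) (by omega)
    rcases h.add x y H.ne H.xy with hs | hs
    · exact absurd hs s2
    · exact absurd hs s1
  · push Not at hall
    obtain ⟨p, hp, h1, h2⟩ := hall
    exact ⟨w, w', p, hne, h1.symm, h2.symm, hf w hw, hf w' hw', hf p hp⟩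

end

/-! ### Vertices whose neighbourhood is a clique -/

section

variable {V : Type*} {G : SimpleGraph V} {v a b e : V}

/-- The claw created by joining two such vertices would have one of them as centre. So all vertices
of negative weight lie in a single clique. -/
theorem adj_of_not_nonSimplicial (h : Sat G) {p : V} (hv : ¬ NonSimplicial G v)
    (hp : ¬ NonSimplicial G p) (hne : v ≠ p) : G.Adj v p := by
  by_contra hc
  rcases h.add v p hne hc with ⟨a, b, h1, h2, h3, h4, -⟩ | ⟨a, b, h1, h2, h3, h4, -⟩
  · exact hv ⟨a, b, h1, h2, h3, h4⟩
  · exact hp ⟨a, b, h1, h2, h3, h4⟩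

theorem adj_of_simplicial (hv : ¬ NonSimplicial G v) (ha : G.Adj v a) (hb : G.Adj v b)
    (hab : a ≠ b) : G.Adj a b := by
  by_contra hc
  exact hv ⟨a, b, ha, hb, hab, hc⟩

theorem nonSimplicial_of_outer {w : V} (hva : G.Adj v a) (haw : G.Adj a w) (hwv : w ≠ v)
    (hwv' : ¬ G.Adj w v) : NonSimplicial G a :=
  ⟨w, v, haw, hva.symm, hwv, hwv'⟩

/-- Neighbours of `a` that are far from `v` form a clique. -/
theorem outer_adj (h : Sat G) (hva : G.Adj v a) {p q : V} (hp : G.Adj a p) (hq : G.Adj a q)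
    (hpv : ¬ G.Adj p v) (hqv : ¬ G.Adj q v) (hpv' : p ≠ v) (hqv' : q ≠ v) (hpq : p ≠ q) :
    G.Adj p q :=
  Far.adj h hva ⟨hp, hpv', hpv⟩ ⟨hq, hqv', hqv⟩ hpq

variable [Fintype V] [DecidableRel G.Adj]

theorem not_isHub_of_adj (h : Sat G) (hv : ¬ NonSimplicial G v) (hd : G.degree v ≤ 3)
    (hva : G.Adj v a) : ¬ IsHub G a := by
  rintro ⟨q, x, y, H⟩
  have := H.unique h hva.symm hd
  subst this
  exact hv H.nonSimplicial

/-- The private neighbours `w` of `a` and `w'` of `b` both see `x` and `s`, and every other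
neighbour of either sees `x` or `s`. Hence neither can be the centre for `xs`; nor can `a` or `b`,
which miss `s`. That centre is a sixth neighbour of `x`. -/
theorem six_le_of_simplicial_degree_two (h : Sat G)
    (hva : G.Adj v a) (hvb : G.Adj v b) (hN : ∀ t, G.Adj v t → t = a ∨ t = b)
    {x w w' : V} (hax : G.Adj a x) (hbx : G.Adj b x) (hxv : x ≠ v)
    (haw : G.Adj a w) (hwv : w ≠ v) (hwb : ¬ G.Adj w b) (hwb' : w ≠ b)
    (hbw' : G.Adj b w') (hwv' : w' ≠ v) (hwa : ¬ G.Adj w' a) (hwa' : w' ≠ a) (hab : G.Adj a b)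
    {s : V} (hxs : G.Adj x s) (hsa : ¬ G.Adj s a) (hsb : ¬ G.Adj s b) (hsa' : s ≠ a)
    (hsb' : s ≠ b) : 6 ≤ G.degree x := by
  have hnv : ∀ t, t ≠ a → t ≠ b → ¬ G.Adj t v := fun t h1 h2 e => by
    rcases hN t e.symm with rfl | rfl
    · exact h1 rfl
    · exact h2 rfl
  have key : ∀ {a b w s : V}, G.Adj v a → a ≠ b → (∀ t, t ≠ a → t ≠ b → ¬ G.Adj t v) →
      G.Adj a x → G.Adj b x → x ≠ v →
      G.Adj a w → w ≠ v → ¬ G.Adj w b → w ≠ b → G.Adj x s → ¬ G.Adj s a → ¬ G.Adj s b → s ≠ a →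
      s ≠ b → G.Adj x w ∧ G.Adj w s ∧ ∀ t, G.Adj w t → t ≠ x → ¬ G.Adj t x → t ≠ s → ¬ G.Adj t s →
        False := by
    intro a b w s hva hab hnv hax hbx hxv haw hwv hwb hwb' hxs hsa hsb hsa' hsb'
    have hxv' := hnv x hax.ne.symm hbx.ne.symm
    have hwv' := hnv w haw.ne.symm hwb'
    have hxw : x ≠ w := fun e => hwb (e ▸ hbx.symm)
    have hadj := outer_adj h hva hax haw hxv' hwv' hxv hwv hxw
    have hws : G.Adj w s := h.free x b w s hbx.symm hadj hxs hwb'.symm hsb'.symm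
      (fun e => hsa (e ▸ haw.symm)) (fun e => hwb e.symm) (fun e => hsb e.symm)
    refine ⟨hadj, hws, ?_⟩
    intro t hwt htx htx' hts hts'
    have hta : t ≠ a := fun e => htx' (e ▸ hax)
    have htv : t ≠ v := fun e => hwv' (e ▸ hwt)
    have htb : t ≠ b := fun e => hwb (e ▸ hwt)
    by_cases hat : G.Adj a t
    · exact htx' (outer_adj h hva hat hax (hnv t hta htb) hxv' htv hxv htx)
    · exact hts' (h.free w a t s haw.symm hwt hws hta.symm hsa'.symm hts hat
        (fun e => hsa e.symm))
  obtain ⟨d1, d2, d3⟩ := key hva hab.ne hnv hax hbx hxv haw hwv hwb hwb' hxs hsa hsb hsa' hsb'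
  obtain ⟨d4, d5, d6⟩ := key hvb hab.ne.symm (fun t h1 h2 => hnv t h2 h1) hbx hax hxv hbw' hwv'
    hwa hwa' hxs hsb hsa hsb' hsa'
  obtain ⟨t, p, h1, h2, h3, h4, h5, h6, h7⟩ := h.rem x s hxs
  have e1 : t ≠ w := fun e => d3 p (e ▸ h3) h4 h6 h5 h7
  have e2 : t ≠ w' := fun e => d6 p (e ▸ h3) h4 h6 h5 h7
  have e3 : t ≠ a := fun e => hsa (e ▸ h2.symm)
  have e4 : t ≠ b := fun e => hsb (e ▸ h2.symm)
  have e5 := h2.ne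
  have e6 : w ≠ w' := fun e => hwb (e ▸ hbw'.symm)
  have e7 : w ≠ s := d2.ne
  have e8 : w' ≠ s := d5.ne
  have e9 := haw.ne
  have e10 := hbw'.ne
  have e11 := hab.ne
  exact length_le_degree [a, b, w, w', s, t] (by clear key d3 d6 hN hnv; grind)
    (by simp [hax.symm, hbx.symm, d1, d4, hxs, h1.symm])

theorem simplicial_degree_two (h : Sat G) (hv : ¬ NonSimplicial G v) (hd : G.degree v ≤ 3)
    (hva : G.Adj v a) (hvb : G.Adj v b) (hab : a ≠ b) (hN : ∀ t, G.Adj v t → t = a ∨ t = b) :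
    NonSimplicial G a ∧ NonSimplicial G b ∧
      (1 ≤ weight G a ∧ 1 ≤ weight G b ∨ ∃ x, x ≠ v ∧ 2 ≤ weight G x) := by
  have hadj := adj_of_simplicial hv hva hvb hab
  have center : ∀ {a b : V}, a ≠ b → (∀ t, G.Adj v t → t = a ∨ t = b) → G.Adj v b →
      ∃ w, G.Adj a w ∧ w ≠ v ∧ ¬ G.Adj w v ∧ ¬ G.Adj w b ∧ w ≠ b := by
    intro a b hab hN hvb
    obtain ⟨c, w, h1, h2, h3, h4, h5, h6, h7⟩ := h.rem v b hvb
    rcases hN c h1.symm with rfl | rfl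
    · exact ⟨w, h3, h4, h6, h7, h5⟩
    · exact absurd rfl h2.ne
  obtain ⟨w, haw, hwv, hwvn, hwb, hwb'⟩ := center hab hN hvb
  obtain ⟨w', hbw', hwv', hwvn', hwa, hwa'⟩ := center hab.symm (fun t ht => (hN t ht).symm) hva
  refine ⟨nonSimplicial_of_outer hva haw hwv hwvn, nonSimplicial_of_outer hvb hbw' hwv' hwvn', ?_⟩
  have hah := not_isHub_of_adj h hv hd hva
  have hbh := not_isHub_of_adj h hv hd hvb
  obtain ⟨x, s, h1, h2, h3, h4, h5, h6, h7⟩ := h.rem a b hadj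
  have hxv : x ≠ v := by
    rintro rfl
    rcases hN s h3 with rfl | rfl
    · exact h4 rfl
    · exact h5 rfl
  have h6x := six_le_of_simplicial_degree_two h hva hvb hN h1.symm h2.symm hxv haw hwv hwb hwb'
    hbw' hwv' hwa hwa' hadj h3 h6 h7 h4 h5
  -- If `x` is a hub, `a` and `b` are far for its cubic vertex and pay one unit each. If not, `x`
  -- alone pays two.
  by_cases hxh : IsHub G x
  · left
    obtain ⟨q, p₁, p₂, H⟩ := hxh
    have hvq : v ≠ q := by
      rintro rfl
      exact hv H.nonSimplicial
    have hqdeg := H.degree_eq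
    have hna : ∀ {u}, G.Adj v u → ¬ IsHub G u → G.Adj x u → Far G q x u := by
      intro u hu huh hxu
      have hqv : ¬ G.Adj q v := by
        intro hqv
        rcases H.nbr v hqv with rfl | rfl | rfl
        · have := H.four_le_side h
          omega
        · exact hxv rfl
        · have := H.symm.four_le_side h
          omega
      have huq : u ≠ q := by
        rintro rfl
        exact hqv hu.symm
      refine ⟨hxu, huq, fun huq' => ?_⟩
      rcases h.add q v hvq.symm hqv with hs | ⟨c, d, g1, g2, g3, g4, -⟩
      · have := H.spread hs
        rcases H.nbr u huq'.symm with rfl | rfl | rfl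
        · exact this.1 hu
        · exact huh ⟨q, p₁, p₂, H⟩
        · exact this.2 hu
      · exact hv ⟨c, d, g1, g2, g3, g4⟩
    exact ⟨one_le_weight (H.five_le_of_far h (hna hva hah h1)) hah,
      one_le_weight (H.five_le_of_far h (hna hvb hbh h2)) hbh⟩
  · right
    refine ⟨x, hxv, ?_⟩
    have := le_weight_of_not_isHub hxh
    omega

theorem weight_of_not_nonSimplicial (hv : ¬ NonSimplicial G v) :
    weight G v = (G.degree v : ℤ) - 4 := by
  unfold weight
  rw [if_neg, if_neg]
  · ring
  · exact fun hc => hv hc.nonSimplicial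
  · rintro ⟨x, z, y, H⟩
    exact hv H.nonSimplicial

theorem simplicial_twins (h : Sat G) (hv : ¬ NonSimplicial G v) (he : ¬ NonSimplicial G e)
    (hd : G.degree v ≤ 3) (hva : G.Adj v a) (hvb : G.Adj v b) (hve : G.Adj v e) (hab : a ≠ b)
    (hae : a ≠ e) (hbe : b ≠ e) (hN : ∀ t, G.Adj v t → t = a ∨ t = b ∨ t = e) :
    1 ≤ weight G a ∧ 1 ≤ weight G b := by
  have hadj := adj_of_simplicial hv hva hvb hab
  -- The twin `e` sees nothing beyond `v` and its neighbours, so it cannot be a centre for `vb`;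
  -- that centre must be `a`.
  have hNe : ∀ t, G.Adj e t → t = v ∨ G.Adj v t := by
    intro t ht
    by_contra hc
    push Not at hc
    exact he ⟨v, t, hve.symm, ht, hc.1.symm, hc.2⟩
  have key : ∀ {a b : V}, G.Adj v a → G.Adj v b → G.Adj a b → a ≠ e → b ≠ e →
      (∀ t, G.Adj v t → t = a ∨ t = b ∨ t = e) → 1 ≤ weight G a := by
    intro a b hva hvb hadj hae hbe hN
    obtain ⟨c, w, h1, h2, h3, h4, h5, h6, h7⟩ := h.rem v b hvb
    have hca : c = a := by
      rcases hN c h1.symm with rfl | rfl | rfl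
      · rfl
      · exact absurd rfl h2.ne
      · rcases hNe w h3 with rfl | h8
        · exact absurd rfl h4
        · exact absurd h8.symm h6
    subst hca
    obtain ⟨x, s, g1, g2, g3, g4, g5, g6, g7⟩ := h.rem c b hadj
    have hxv : x ≠ v := by
      rintro rfl
      rcases hN s g3 with rfl | rfl | rfl
      · exact g4 rfl
      · exact g5 rfl
      · exact g6 (adj_of_simplicial hv g3 hva hae.symm)
    have hxe : x ≠ e := by
      rintro rfl
      rcases hNe s g3 with rfl | h8
      · exact g6 hva
      · exact g6 (adj_of_simplicial hv h8 hva g4)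
    have hce := adj_of_simplicial hv hva hve hae
    have e1 : w ≠ x := fun e => h7 (e ▸ g2)
    have e2 : w ≠ e := fun e' => h6 (e' ▸ hve.symm)
    have e3 := hvb.ne
    have e4 := hve.ne
    have e5 := g2.ne
    refine one_le_weight ?_ (not_isHub_of_adj h hv hd hva)
    exact length_le_degree [v, b, e, x, w] (by grind) (by simp [h1, hadj, hce, g1.symm, h3])
  exact ⟨key hva hvb hadj hae hbe hN, key hvb hva hadj.symm hbe hae
    (fun t ht => by have := hN t ht; tauto)⟩

theorem exists_heavy_of_simplicial (h : Sat G) (hv : ¬ NonSimplicial G v)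
    (hd : G.degree v ≤ 3) (hva : G.Adj v a) (hvb : G.Adj v b) (hve : G.Adj v e) (hab : a ≠ b)
    (hae : a ≠ e) (hbe : b ≠ e) (hN : ∀ t, G.Adj v t → t = a ∨ t = b ∨ t = e)
    (ha : NonSimplicial G a) (hb : NonSimplicial G b) (he : NonSimplicial G e) :
    ∃ x, x ≠ v ∧ 1 ≤ weight G x := by
  have hab' := adj_of_simplicial hv hva hvb hab
  have hae' := adj_of_simplicial hv hva hve hae
  have hbe' := adj_of_simplicial hv hvb hve hbe
  have outer : ∀ {a b e : V}, G.Adj v a → G.Adj a b → G.Adj a e → b ≠ e → G.Adj v b →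
      G.Adj v e → (∀ t, G.Adj v t → t = a ∨ t = b ∨ t = e) → G.Adj b e →
      NonSimplicial G a → G.degree a ≤ 4 →
      ∃ o, G.Adj a o ∧ o ≠ v ∧ ¬ G.Adj o v ∧ o ≠ b ∧ o ≠ e ∧
        (∀ t, G.Adj a t → t = v ∨ t = b ∨ t = e ∨ t = o) := by
    intro a b e hva hab hae hbe hvb hve hN hbe' ha hda
    have hex : ∃ o, G.Adj a o ∧ o ≠ v ∧ ¬ G.Adj v o := by
      by_contra hc
      push Not at hc
      obtain ⟨p, q, h1, h2, h3, h4⟩ := ha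
      by_cases hp : p = v
      · subst hp
        exact h4 (hc q h2 h3.symm)
      by_cases hq : q = v
      · subst hq
        exact h4 (hc p h1 h3).symm
      exact h4 (adj_of_simplicial hv (hc p h1 hp) (hc q h2 hq) h3)
    obtain ⟨o, h1, h2, h3⟩ := hex
    have e1 : o ≠ b := fun e => h3 (e ▸ hvb)
    have e2 : o ≠ e := fun e' => h3 (e' ▸ hve)
    have e3 := hvb.ne
    have e4 := hve.ne
    refine ⟨o, h1, h2, fun e => h3 e.symm, e1, e2, ?_⟩
    intro t ht
    have := mem_of_degree_le [v, b, e, o] (by grind) (by simp [hva.symm, hab, hae, h1])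
      (by simpa using hda) ht
    simpa using this
  by_contra hc
  push Not at hc
  -- If nothing is heavy, each of `a`, `b`, `e` has a single neighbour away from `v`. Common
  -- neighbours along those edges force the three outside vertices to coincide, and then `va` has no
  -- third leaf.
  have hsmall : ∀ {u}, G.Adj v u → G.degree u ≤ 4 := by
    intro u hu
    by_contra hdu
    have := hc u hu.ne.symm
    have := one_le_weight (G := G) (v := u) (by omega) (not_isHub_of_adj h hv hd hu)
    omega
  obtain ⟨oa, a1, a2, a3, a4, a5, a6⟩ := outer hva hab' hae' hbe hvb hve hN hbe' ha (hsmall hva)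
  obtain ⟨ob, b1, b2, b3, b4, b5, b6⟩ := outer hvb hab'.symm hbe' hae hva hve
    (fun t ht => by have := hN t ht; tauto) hae' hb (hsmall hvb)
  obtain ⟨oe, c1, c2, c3, c4, c5, c6⟩ := outer hve hae'.symm hbe'.symm hab hva hvb
    (fun t ht => by have := hN t ht; tauto) hab' he (hsmall hve)
  have share : ∀ {a b e oa ob oe : V}, G.Adj a oa → ¬ G.Adj oa v →
      (∀ t, G.Adj a t → t = v ∨ t = b ∨ t = e ∨ t = oa) →
      (∀ t, G.Adj b t → t = v ∨ t = a ∨ t = e ∨ t = ob) →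
      (∀ t, G.Adj e t → t = v ∨ t = a ∨ t = b ∨ t = oe) → oa ≠ v → oa ≠ e → oa ≠ b →
      oa = ob ∨ oa = oe := by
    intro a b e oa ob oe h1 h2 h3 h4 h5 h6 h7 h8
    obtain ⟨c, g1, g2⟩ := h.exists_common h1
    have e1 := h1.ne
    have e2 := g2.ne
    rcases h3 c g1.symm with rfl | rfl | rfl | rfl
    · exact absurd g2.symm h2
    · have := h4 oa g2
      grind
    · have := h5 oa g2
      grind
    · exact absurd rfl e2
  have s1 := share a1 a3 a6 b6 c6 a2 a5 a4
  have s2 := share (a := b) (b := a) (e := e) (oa := ob) (ob := oa) (oe := oe) b1 b3 b6 a6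
    (fun t ht => by have := c6 t ht; tauto) b2 b5 b4
  have s3 := share (a := e) (b := a) (e := b) (oa := oe) (ob := oa) (oe := ob) c1 c3 c6
    (fun t ht => by have := a6 t ht; tauto) (fun t ht => by have := b6 t ht; tauto) c2 c5 c4
  have hall : oa = ob ∧ oa = oe := by grind
  obtain ⟨rfl, rfl⟩ := hall
  obtain ⟨c, w, h1, h2, h3, h4, h5, h6, h7⟩ := h.rem v a hva
  have f1 := h2.ne
  have f2 := a1.symm
  rcases hN c h1.symm with rfl | rfl | rfl
  · exact f1 rfl
  · rcases b6 w h3 with rfl | rfl | rfl | rfl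
    · exact h4 rfl
    · exact h5 rfl
    · exact h6 hve.symm
    · exact h7 f2
  · rcases c6 w h3 with rfl | rfl | rfl | rfl
    · exact h4 rfl
    · exact h5 rfl
    · exact h6 hvb.symm
    · exact h7 f2

theorem sum_weight_nonneg_of_subset (S : Finset V) (hS : 0 ≤ ∑ v ∈ S, weight G v)
    (h : ∀ v, v ∉ S → 0 ≤ weight G v) : 0 ≤ ∑ v, weight G v := by
  classical
  rw [← Finset.sum_add_sum_compl S]
  exact add_nonneg hS (Finset.sum_nonneg fun v hv => h v (by simpa using hv))

theorem Sat.sum_weight_nonneg (h : Sat G) (hpos : ∀ v, 0 < G.degree v) :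
    0 ≤ ∑ v, weight G v := by
  classical
  by_cases hall : ∀ v, 0 ≤ weight G v
  · exact Finset.sum_nonneg fun v _ => hall v
  push Not at hall
  obtain ⟨v, hvw⟩ := hall
  have hns : ∀ {u}, weight G u < 0 → ¬ NonSimplicial G u := fun {u} hu hc =>
    absurd (h.weight_nonneg hc) (by omega)
  have hv := hns hvw
  have hwv := weight_of_not_nonSimplicial hv
  have hd : G.degree v ≤ 3 := by omega
  have hneg : ∀ u, u ≠ v → ¬ G.Adj v u → 0 ≤ weight G u := by
    intro u huv hu
    by_contra hc
    exact hu (adj_of_not_nonSimplicial h hv (hns (by omega)) huv.symm)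
  have hnn : ∀ {u}, NonSimplicial G u → 0 ≤ weight G u := fun hu => h.weight_nonneg hu
  obtain ⟨u, hu⟩ := (G.degree_pos_iff_exists_adj v).1 (hpos v)
  -- A centre for an edge at `v` is a neighbour of `v` with a neighbour outside. Doing this twice
  -- gives two distinct such neighbours `a` and `b`, so the deficit of `v` is at most two.
  obtain ⟨a, w, h1, h2, h3, h4, h5, h6, h7⟩ := h.rem v u hu
  have ha : NonSimplicial G a := nonSimplicial_of_outer h1.symm h3 h4 h6
  obtain ⟨b, w', g1, g2, g3, g4, g5, g6, g7⟩ := h.rem v a h1.symm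
  have hb : NonSimplicial G b := nonSimplicial_of_outer g1.symm g3 g4 g6
  have hab := g2.ne.symm
  have hav := h1.ne
  have hbv := g1.ne
  have pair : ∀ x, x ≠ v → (∀ u, G.Adj v u → u ≠ x → 0 ≤ weight G u) →
      0 ≤ weight G v + weight G x → 0 ≤ ∑ v, weight G v := by
    intro x hx hu hs
    refine sum_weight_nonneg_of_subset {v, x} ?_ ?_
    · rwa [Finset.sum_pair hx.symm]
    · intro p hp
      simp only [Finset.mem_insert, Finset.mem_singleton, not_or] at hp
      by_cases hpv : G.Adj v p
      · exact hu p hpv hp.2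
      · exact hneg p hp.1 hpv
  by_cases hN : ∀ t, G.Adj v t → t = a ∨ t = b
  · obtain ⟨-, -, hw⟩ := simplicial_degree_two h hv hd h1.symm g1.symm hab hN
    have hd2 : 2 ≤ G.degree v := length_le_degree [a, b] (by simpa using hab)
      (by simp [h1.symm, g1.symm])
    rcases hw with ⟨hwa, hwb⟩ | ⟨x, hxv, hx⟩
    · refine sum_weight_nonneg_of_subset {v, a, b} ?_ ?_
      · rw [Finset.sum_insert (by simp [hav.symm, hbv.symm]), Finset.sum_pair hab]
        omega
      · intro p hp
        simp only [Finset.mem_insert, Finset.mem_singleton, not_or] at hp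
        exact hneg p hp.1 fun hc => by have := hN p hc; tauto
    · refine pair x hxv (fun u hu _ => ?_) (by omega)
      rcases hN u hu with rfl | rfl
      exacts [hnn ha, hnn hb]
  · push Not at hN
    obtain ⟨e, hve, hea, heb⟩ := hN
    have hd3 : 3 ≤ G.degree v := length_le_degree [a, b, e] (by grind)
      (by simp [h1.symm, g1.symm, hve])
    have hN : ∀ t, G.Adj v t → t = a ∨ t = b ∨ t = e := fun t ht => by
      simpa using mem_of_degree_le [a, b, e] (by grind) (by simp [h1.symm, g1.symm, hve]) hd ht
    by_cases he : NonSimplicial G e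
    · obtain ⟨x, hxv, hx⟩ := exists_heavy_of_simplicial h hv hd h1.symm g1.symm hve hab
        hea.symm heb.symm hN ha hb he
      refine pair x hxv (fun u hu _ => ?_) (by omega)
      rcases hN u hu with rfl | rfl | rfl
      exacts [hnn ha, hnn hb, hnn he]
    · obtain ⟨hwa, hwb⟩ := simplicial_twins h hv he hd h1.symm g1.symm hve hab
        hea.symm heb.symm hN
      have hde : 3 ≤ G.degree e := by
        have hea' := adj_of_simplicial hv hve h1.symm hea
        have heb' := adj_of_simplicial hv hve g1.symm heb
        exact length_le_degree [v, a, b] (by grind) (by simp [hve.symm, hea', heb'])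
      have hwe := weight_of_not_nonSimplicial he
      refine sum_weight_nonneg_of_subset {v, e, a, b} ?_ ?_
      · have := hve.ne
        rw [Finset.sum_insert (by simp [hav.symm, hbv.symm, this]),
          Finset.sum_insert (by simp [hea, heb]), Finset.sum_pair hab]
        omega
      · intro p hp
        simp only [Finset.mem_insert, Finset.mem_singleton, not_or] at hp
        exact hneg p hp.1 fun hc => by have := hN p hc; tauto

theorem Sat.two_mul_card_le (h : Sat G) (hpos : ∀ v, 0 < G.degree v) :
    2 * Fintype.card V ≤ G.edgeSet.ncard := by
  classical
  have h1 := h.sum_weight_nonneg hpos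
  have h2 := h.sum_weight_le Finset.univ (fun z _ => Finset.mem_univ z)
  have h3 := G.sum_degrees_eq_twice_card_edges
  rw [Finset.sum_sub_distrib, ← Nat.cast_sum, h3] at h2
  simp only [Finset.sum_const, Finset.card_univ, nsmul_eq_mul] at h2
  rw [← coe_edgeFinset, Set.ncard_coe_finset]
  push_cast at h2
  omega

end

/-! ### Total excess at most two: neighbourhoods containing a triangle -/

section

variable {V : Type*} [Fintype V] {G : SimpleGraph V} [DecidableRel G.Adj] {v a b c d : V}

/-- A saturated graph whose nonisolated vertices have degree at least four and non-clique
neighbourhoods, and whose total excess of degrees over four is at most two. -/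
structure Tight (G : SimpleGraph V) [DecidableRel G.Adj] : Prop where
  sat : Sat G
  ns : ∀ v, 0 < G.degree v → NonSimplicial G v
  four : ∀ v, 0 < G.degree v → 4 ≤ G.degree v
  excess : ∀ S : Finset V, ∑ v ∈ S, (G.degree v - 4) ≤ 2

theorem degree_pos_of_adj (h : G.Adj v a) : 0 < G.degree v :=
  (G.degree_pos_iff_exists_adj v).2 ⟨a, h⟩

theorem Tight.three (T : Tight G) (hab : a ≠ b) (hac : a ≠ c) (hbc : b ≠ c)
    (ha : 5 ≤ G.degree a) (hb : 5 ≤ G.degree b) (hc : 5 ≤ G.degree c) : False := by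
  classical
  have := T.excess {a, b, c}
  rw [Finset.sum_insert (by simp [hab, hac]), Finset.sum_pair hbc] at this
  omega

theorem Tight.two (T : Tight G) (hab : a ≠ b) (ha : 6 ≤ G.degree a) : G.degree b ≤ 4 := by
  classical
  have := T.excess {a, b}
  rw [Finset.sum_pair hab] at this
  omega

theorem Tight.degree_le_six (T : Tight G) : G.degree v ≤ 6 := by
  have := T.excess {v}
  rw [Finset.sum_singleton] at this
  omega

theorem Tight.pair (T : Tight G) (hab : a ≠ b) (hb : 5 ≤ G.degree b) : G.degree a ≤ 5 := by
  by_contra hc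
  have := T.two hab (by omega)
  omega

/-- With third leaves `s` for `va` and `r` for `vc`, both at the centre `b`, the degree of `b` is
six. This uses up the excess, so neighbours of `b` have degree four. The centre for `bs` is then
`r`, and its fourth neighbour `y` yields a claw at `r` with leaves `a`, `y`, `s`. -/
theorem Tight.paw_aux (T : Tight G) (hvc : G.Adj v c) (hvd : G.Adj v d)
    (hbv : G.Adj b v) (hba : G.Adj b a) (hbc : G.Adj b c) (hbd : G.Adj b d) (hcd : G.Adj c d)
    (hav : G.Adj a v) (hac : ¬ G.Adj a c) (hac' : a ≠ c) (had : ¬ G.Adj a d) (had' : a ≠ d)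
    (hN : ∀ t, G.Adj v t → t = a ∨ t = b ∨ t = c ∨ t = d)
    {s r : V} (hbs : G.Adj b s) (hsv : s ≠ v) (hsv' : ¬ G.Adj s v) (hsa : s ≠ a)
    (hsa' : ¬ G.Adj s a) (hsc : G.Adj s c) (hsd : G.Adj s d)
    (hbr : G.Adj b r) (hrv : r ≠ v) (hrv' : ¬ G.Adj r v) (hrc : r ≠ c)
    (hrc' : ¬ G.Adj r c) : False := by
  have h := T.sat
  have har : G.Adj a r := h.free b c a r hbc hba hbr hac'.symm hrc.symm
    (fun e => hrv' (e ▸ hav)) (fun e => hac e.symm) (fun e => hrc' e.symm)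
  have hrs : r ≠ s := fun e => hrc' (e ▸ hsc)
  have hra : r ≠ a := fun e => hrv' (e ▸ hav)
  have hrd : r ≠ d := fun e => hrc' (e ▸ hcd.symm)
  have hac1 := hav.ne
  have hvc1 := hvc.ne
  have hvd1 := hvd.ne
  have hcd1 := hcd.ne
  have hsc1 := hsc.ne
  have hsd1 := hsd.ne
  have hb6 : 6 ≤ G.degree b := length_le_degree [a, v, c, d, s, r] (by grind)
    (by simp [hba, hbv, hbc, hbd, hbs, hbr])
  have hNb : ∀ t, G.Adj b t → t = a ∨ t = v ∨ t = c ∨ t = d ∨ t = s ∨ t = r := fun t ht => by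
    simpa using mem_of_degree_le [a, v, c, d, s, r] (by grind)
      (by simp [hba, hbv, hbc, hbd, hbs, hbr]) (by simpa using T.degree_le_six) ht
  have hNc : ∀ t, G.Adj c t → t = v ∨ t = b ∨ t = d ∨ t = s := fun t ht => by
    have h1 := hbv.ne
    have h2 := hbd.ne
    have h3 := hbs.ne
    simpa using mem_of_degree_le [v, b, d, s] (by grind)
      (by simp [hvc.symm, hbc.symm, hcd, hsc.symm]) (by simpa using T.two hbc.ne hb6) ht
  have hNd : ∀ t, G.Adj d t → t = v ∨ t = b ∨ t = c ∨ t = s := fun t ht => by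
    have h1 := hbv.ne
    have h2 := hbc.ne
    have h3 := hbs.ne
    simpa using mem_of_degree_le [v, b, c, s] (by grind)
      (by simp [hvd.symm, hbd.symm, hcd.symm, hsd.symm]) (by simpa using T.two hbd.ne hb6) ht
  obtain ⟨p, y, g1, g2, g3, g4, g5, g6, g7⟩ := h.rem b s hbs
  have hpr : p = r := by
    rcases hNb p g1.symm with rfl | rfl | rfl | rfl | rfl | rfl
    · exact absurd g2.symm hsa'
    · exact absurd g2.symm hsv'
    · rcases hNc y g3 with rfl | rfl | rfl | rfl
      · exact absurd hbv.symm g6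
      · exact absurd rfl g4
      · exact absurd hbd.symm g6
      · exact absurd rfl g5
    · rcases hNd y g3 with rfl | rfl | rfl | rfl
      · exact absurd hbv.symm g6
      · exact absurd rfl g4
      · exact absurd hbc.symm g6
      · exact absurd rfl g5
    · exact absurd rfl g2.ne
    · rfl
  subst hpr
  have hya : y ≠ a := fun e => g6 (e ▸ hba.symm)
  have hNp : ∀ t, G.Adj p t → t = b ∨ t = a ∨ t = s ∨ t = y := fun t ht => by
    have h1 := hba.ne
    have h2 := hbs.ne
    simpa using mem_of_degree_le [b, a, s, y] (by grind)
      (by simp [g1, har.symm, g2, g3]) (by simpa using T.two hbr.ne hb6) ht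
  have hay : ¬ G.Adj a y := by
    obtain ⟨q, t, f1, f2, f3, f4, f5, f6, f7⟩ := h.rem a b hba.symm
    have f8 := f1.ne
    rcases hNb q f2.symm with rfl | rfl | rfl | rfl | rfl | rfl
    · exact absurd rfl f8
    · rcases hN t f3 with rfl | rfl | rfl | rfl
      · exact absurd rfl f4
      · exact absurd rfl f5
      · exact absurd hbc.symm f7
      · exact absurd hbd.symm f7
    · exact absurd f1.symm hac
    · exact absurd f1.symm had
    · exact absurd f1 hsa'
    · rcases hNp t f3 with rfl | rfl | rfl | rfl
      · exact absurd rfl f5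
      · exact absurd rfl f4
      · exact absurd hbs.symm f7
      · exact fun e => f6 e.symm
  exact g7 (h.free p a y s har.symm g3 g2 hya.symm hsa.symm g5 hay (fun e => hsa' e.symm))

/-- The centre for `va` is `b`, and its third leaf sees `c` and `d`. By `paw_aux` the centres for
`vc` and `vd` are `d` and `c`, so `b`, `c`, `d` all have degree at least five. -/
theorem Tight.no_paw (T : Tight G) (hvc : G.Adj v c) (hvd : G.Adj v d)
    (hbv : G.Adj b v) (hba : G.Adj b a) (hbc : G.Adj b c) (hbd : G.Adj b d) (hcd : G.Adj c d)
    (hav : G.Adj a v) (hac : ¬ G.Adj a c) (hac' : a ≠ c) (had : ¬ G.Adj a d) (had' : a ≠ d)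
    (hN : ∀ t, G.Adj v t → t = a ∨ t = b ∨ t = c ∨ t = d) : False := by
  have h := T.sat
  obtain ⟨p, s, g1, g2, g3, g4, g5, g6, g7⟩ := h.rem v a hav.symm
  have hpb : p = b := by
    rcases hN p g1.symm with rfl | rfl | rfl | rfl
    · exact absurd rfl g2.ne
    · rfl
    · exact absurd g2.symm hac
    · exact absurd g2.symm had
  subst hpb
  have hsc : G.Adj s c := (h.free p a c s hba hbc g3 hac' g5.symm
    (fun e => g6 (e ▸ hvc.symm)) hac (fun e => g7 e.symm)).symm
  have hsd : G.Adj s d := (h.free p a d s hba hbd g3 had' g5.symm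
    (fun e => g6 (e ▸ hvd.symm)) had (fun e => g7 e.symm)).symm
  have key : ∀ {c d : V}, G.Adj v c → G.Adj v d → G.Adj p c → G.Adj p d → G.Adj c d →
      ¬ G.Adj a c → a ≠ c → ¬ G.Adj a d → a ≠ d → G.Adj s c → G.Adj s d →
      (∀ t, G.Adj v t → t = a ∨ t = p ∨ t = c ∨ t = d) → 5 ≤ G.degree d := by
    intro c d hvc hvd hbc hbd hcd hac hac' had had' hsc hsd hN
    obtain ⟨q, r, f1, f2, f3, f4, f5, f6, f7⟩ := h.rem v c hvc
    have f8 := f2.ne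
    rcases hN q f1.symm with rfl | rfl | rfl | rfl
    · exact absurd f2 hac
    · exact (T.paw_aux hvc hvd hbv hba hbc hbd hcd hav hac hac' had had' hN g3 g4 g6 g5 g7
        hsc hsd f3 f4 f6 f5 f7).elim
    · exact absurd rfl f8
    · have h1 := hbv.ne
      have h2 := hvc.ne
      have h3 := hbc.ne
      have h4 := g3.ne
      have h5 := hsc.ne
      have h6 : r ≠ p := fun e => f6 (e ▸ hbv)
      have h7 : r ≠ s := fun e => f7 (e ▸ hsc)
      exact length_le_degree [v, p, c, s, r] (by grind)
        (by simp [f1, hbd.symm, f2, hsd.symm, f3])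
  have hd5 := key hvc hvd hbc hbd hcd hac hac' had had' hsc hsd hN
  have hc5 := key hvd hvc hbd hbc hcd.symm had had' hac hac' hsd hsc
    (fun t ht => by have := hN t ht; tauto)
  have hb5 : 5 ≤ G.degree p := by
    have h1 := hav.ne
    have h2 := hvc.ne
    have h3 := hvd.ne
    have h4 := hcd.ne
    have h5 := hsc.ne
    have h6 := hsd.ne
    exact length_le_degree [a, v, c, d, s] (by grind) (by simp [hba, hbv, hbc, hbd, g3])
  exact T.three hbc.ne hbd.ne hcd.ne hb5 hc5 hd5

/-- The third leaves `s` for `va` and `r` for `vd` hang at `b` or `c`. If both hang at `b`, it has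
degree six, and the remaining degree-four vertices leave no centre for `vb`. If they are split, `b`
and `c` have degree five and there is no centre for `bc`. -/
theorem Tight.no_diamond (T : Tight G) (hva : G.Adj v a) (hvb : G.Adj v b) (hvc : G.Adj v c)
    (hvd : G.Adj v d) (hab : G.Adj a b) (hac : G.Adj a c) (hbc : G.Adj b c) (hbd : G.Adj b d)
    (hcd : G.Adj c d) (had : ¬ G.Adj a d) (had' : a ≠ d)
    (hN : ∀ t, G.Adj v t → t = a ∨ t = b ∨ t = c ∨ t = d) : False := by
  have h := T.sat
  -- a centre for the edge `va` (or `vd`) among `b`, `c`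
  have center : ∀ {a d : V}, G.Adj v a → G.Adj v d → ¬ G.Adj a d → a ≠ d → G.Adj b a →
      G.Adj b d → G.Adj c a → G.Adj c d →
      (∀ t, G.Adj v t → t = a ∨ t = b ∨ t = c ∨ t = d) →
      ∃ s, (G.Adj b s ∨ G.Adj c s) ∧ s ≠ v ∧ ¬ G.Adj s v ∧ s ≠ a ∧ ¬ G.Adj s a ∧ G.Adj d s := by
    intro a d hva hvd had had' hba hbd hca hcd hN
    obtain ⟨p, s, g1, g2, g3, g4, g5, g6, g7⟩ := h.rem v a hva
    have hds : ∀ p, G.Adj p a → G.Adj p d → G.Adj p s → G.Adj d s := fun p g2 hpd g3 =>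
      h.free p a d s g2 hpd g3 had' g5.symm
      (fun e => g6 (e ▸ hvd.symm)) had (fun e => g7 e.symm)
    have g8 := g2.ne
    rcases hN p g1.symm with rfl | rfl | rfl | rfl
    · exact absurd rfl g8
    · exact ⟨s, .inl g3, g4, g6, g5, g7, hds p g2 hbd g3⟩
    · exact ⟨s, .inr g3, g4, g6, g5, g7, hds p g2 hcd g3⟩
    · exact absurd g2.symm had
  obtain ⟨s, s1, s2, s3, s4, s5, s6⟩ := center hva hvd had had' hab.symm hbd hac.symm hcd hN
  obtain ⟨r, r1, r2, r3, r4, r5, r6⟩ := center hvd hva (fun e => had e.symm) had'.symm hbd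
    hab.symm hcd hac.symm (fun t ht => by have := hN t ht; tauto)
  have nab := hab.ne
  have nac := hac.ne
  have nbc := hbc.ne
  have nbd := hbd.ne
  have ncd := hcd.ne
  have nva := hva.ne
  have nvb := hvb.ne
  have nvc := hvc.ne
  have nvd := hvd.ne
  have nsd := s6.ne
  have nra := r6.ne
  have nsr : s ≠ r := fun e => s5 (e ▸ r6.symm)
  have nsb : s ≠ b := fun e => s3 (e ▸ hvb.symm)
  have nsc : s ≠ c := fun e => s3 (e ▸ hvc.symm)
  have nrb : r ≠ b := fun e => r3 (e ▸ hvb.symm)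
  have nrc : r ≠ c := fun e => r3 (e ▸ hvc.symm)
  have same : ∀ {b c : V}, G.Adj v b → G.Adj v c → G.Adj a b → G.Adj a c → G.Adj b c →
      G.Adj b d → G.Adj c d → s ≠ c → r ≠ c →
      (∀ t, G.Adj v t → t = a ∨ t = b ∨ t = c ∨ t = d) →
      G.Adj b s → G.Adj b r → False := by
    intro b c hvb hvc hab hac hbc hbd hcd hsc hrc hN hbs hbr
    have nab := hab.ne
    have nac := hac.ne
    have nbc := hbc.ne
    have nbd := hbd.ne
    have ncd := hcd.ne
    have nvb := hvb.ne
    have nvc := hvc.ne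
    have nbs := hbs.ne
    have nbr := hbr.ne
    have hb6 : 6 ≤ G.degree b := length_le_degree [a, c, d, v, s, r] (by clear center hN; grind)
      (by simp [hab.symm, hbc, hbd, hvb.symm, hbs, hbr])
    have ha4 := T.two hab.ne.symm hb6
    have hc4 := T.two hbc.ne hb6
    have hd4 := T.two hbd.ne hb6
    obtain ⟨p, t, g1, g2, g3, g4, g5, g6, g7⟩ := h.rem v b hvb
    have g8 := g2.ne
    have e1 : t ≠ c := fun e => g6 (e ▸ hvc.symm)
    have e2 : t ≠ s := fun e => g7 (e ▸ hbs.symm)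
    have e3 : t ≠ r := fun e => g7 (e ▸ hbr.symm)
    have e4 : t ≠ a := fun e => g6 (e ▸ hva.symm)
    have e5 : t ≠ d := fun e => g6 (e ▸ hvd.symm)
    rcases hN p g1.symm with rfl | rfl | rfl | rfl
    · have := length_le_degree (G := G) (v := p) [v, b, c, r, t] (by clear center hN; grind)
        (by simp [g1, g2, hac, r6, g3])
      simp at this
      omega
    · exact g8 rfl
    · have := length_le_degree (G := G) (v := p) [v, b, a, d, t] (by clear center hN; grind)
        (by simp [g1, g2, hac.symm, hcd, g3])
      simp at this
      omega
    · have := length_le_degree (G := G) (v := p) [v, b, c, s, t] (by clear center hN; grind)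
        (by simp [g1, g2, hcd.symm, s6, g3])
      simp at this
      omega
  have cross : ∀ {b c : V}, G.Adj v b → G.Adj v c → G.Adj a b → G.Adj a c → G.Adj b c →
      G.Adj b d → G.Adj c d →
      (∀ t, G.Adj v t → t = a ∨ t = b ∨ t = c ∨ t = d) →
      G.Adj b s → G.Adj c r → False := by
    intro b c hvb hvc hab hac hbc hbd hcd hN hbs hcr
    have nab := hab.ne
    have nac := hac.ne
    have nbc := hbc.ne
    have nbd := hbd.ne
    have ncd := hcd.ne
    have nvb := hvb.ne
    have nvc := hvc.ne
    have nbs := hbs.ne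
    have ncr := hcr.ne
    have nsc : s ≠ c := fun e => s3 (e ▸ hvc.symm)
    have nrb : r ≠ b := fun e => r3 (e ▸ hvb.symm)
    have hb5 : 5 ≤ G.degree b := length_le_degree [a, c, d, v, s] (by clear center hN same; grind)
      (by simp [hab.symm, hbc, hbd, hvb.symm, hbs])
    have hc5 : 5 ≤ G.degree c := length_le_degree [a, b, d, v, r] (by clear center hN same; grind)
      (by simp [hac.symm, hbc.symm, hcd, hvc.symm, hcr])
    have hb5' := T.pair nbc hc5
    have hc5' := T.pair nbc.symm hb5
    have ha4 : G.degree a ≤ 4 := by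
      by_contra hc
      exact T.three nab nac nbc (by omega) hb5 hc5
    have hd4 : G.degree d ≤ 4 := by
      by_contra hc
      exact T.three nbc nbd ncd hb5 hc5 (by omega)
    have hNb : ∀ t, G.Adj b t → t ∈ [a, c, d, v, s] := fun t ht =>
      mem_of_degree_le [a, c, d, v, s] (by clear center hN same; grind)
        (by simp [hab.symm, hbc, hbd, hvb.symm, hbs]) (by simpa using hb5') ht
    have hNc : ∀ t, G.Adj c t → t ∈ [a, b, d, v, r] := fun t ht =>
      mem_of_degree_le [a, b, d, v, r] (by clear center hN hNb same; grind)
        (by simp [hac.symm, hbc.symm, hcd, hvc.symm, hcr]) (by simpa using hc5') ht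
    have hNa : ∀ t, G.Adj a t → t ∈ [v, b, c, r] := fun t ht =>
      mem_of_degree_le [v, b, c, r] (by clear center hN hNb hNc same; grind)
        (by simp [hva.symm, hab, hac, r6]) (by simpa using ha4) ht
    have hNd : ∀ t, G.Adj d t → t ∈ [v, b, c, s] := fun t ht =>
      mem_of_degree_le [v, b, c, s] (by clear center hN hNb hNc hNa same; grind)
        (by simp [hvd.symm, hbd.symm, hcd.symm, s6]) (by simpa using hd4) ht
    simp only [List.mem_cons, List.not_mem_nil, or_false] at hNb hNc hNa hNd
    obtain ⟨p, t, g1, g2, g3, g4, g5, g6, g7⟩ := h.rem b c hbc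
    have hp : p = a ∨ p = d ∨ p = v := by
      have h1 := hNb p g1.symm
      have h2 := hNc p g2.symm
      have h3 := g2.ne
      clear center hN hNb hNc hNa hNd same
      grind
    rcases hp with rfl | rfl | rfl
    · rcases hNa t g3 with rfl | rfl | rfl | rfl
      · exact g6 hvb
      · exact g4 rfl
      · exact g5 rfl
      · exact g7 hcr.symm
    · rcases hNd t g3 with rfl | rfl | rfl | rfl
      · exact g6 hvb
      · exact g4 rfl
      · exact g5 rfl
      · exact g6 hbs.symm
    · rcases hN t g3 with rfl | rfl | rfl | rfl
      · exact g6 hab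
      · exact g4 rfl
      · exact g5 rfl
      · exact g6 hbd.symm
  have hN' : ∀ t, G.Adj v t → t = a ∨ t = c ∨ t = b ∨ t = d := fun t ht => by
    have := hN t ht
    tauto
  rcases s1 with s1 | s1 <;> rcases r1 with r1 | r1
  · exact same hvb hvc hab hac hbc hbd hcd nsc nrc hN s1 r1
  · exact cross hvb hvc hab hac hbc hbd hcd hN s1 r1
  · exact cross hvc hvb hac hab hbc.symm hcd hbd hN' s1 r1
  · exact same hvc hvb hac hab hbc.symm hcd hbd nsb nrb hN' s1 r1

end

/-! ### Total excess at most two: wheels -/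

section

variable {V : Type*} {G : SimpleGraph V} {v a b c d z r₀ r₁ r₂ r₃ r₄ : V}

/-- `v` has exactly the neighbours `a`, `b`, `c`, `d`, which induce a cycle in this order. -/
structure FourWheel (G : SimpleGraph V) (v a b c d : V) : Prop where
  va : G.Adj v a
  vb : G.Adj v b
  vc : G.Adj v c
  vd : G.Adj v d
  ab : G.Adj a b
  bc : G.Adj b c
  cd : G.Adj c d
  da : G.Adj d a
  nac : ¬ G.Adj a c
  nbd : ¬ G.Adj b d
  ac : a ≠ c
  bd : b ≠ d
  nbr : ∀ t, G.Adj v t → t = a ∨ t = b ∨ t = c ∨ t = d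

theorem FourWheel.rotate (F : FourWheel G v a b c d) : FourWheel G v b c d a :=
  ⟨F.vb, F.vc, F.vd, F.va, F.bc, F.cd, F.da, F.ab, F.nbd, fun e => F.nac e.symm, F.bd, F.ac.symm,
    fun t ht => by have := F.nbr t ht; tauto⟩

theorem FourWheel.exists_outer_edge (h : Sat G) (F : FourWheel G v a b c d) :
    ∃ y, G.Adj a y ∧ G.Adj b y ∧ y ≠ v ∧ ¬ G.Adj y v := by
  obtain ⟨p, t, g1, g2, g3, g4, g5, g6, g7⟩ := h.rem a b F.ab
  refine ⟨p, g1.symm, g2.symm, ?_, ?_⟩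
  · rintro rfl
    rcases F.nbr t g3 with rfl | rfl | rfl | rfl
    · exact g4 rfl
    · exact g5 rfl
    · exact g7 F.bc.symm
    · exact g6 F.da
  · intro hpv
    rcases F.nbr p hpv.symm with rfl | rfl | rfl | rfl
    · exact g1.ne rfl
    · exact g2.ne rfl
    · exact F.nac g1.symm
    · exact F.nbd g2.symm

theorem FourWheel.exists_outer_opp (h : Sat G) (F : FourWheel G v a b c d) :
    ∃ s, G.Adj c s ∧ s ≠ v ∧ ¬ G.Adj s v ∧ ¬ G.Adj s a := by
  obtain ⟨p, s, g1, g2, g3, g4, g5, g6, g7⟩ := h.rem v a F.va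
  refine ⟨s, ?_, g4, g6, g7⟩
  have hcs : c ≠ s := fun e => g6 (e ▸ F.vc.symm)
  have key : G.Adj p c → G.Adj c s := fun hpc =>
    h.free p a c s g2 hpc g3 F.ac g5.symm hcs F.nac (fun e => g7 e.symm)
  rcases F.nbr p g1.symm with rfl | rfl | rfl | rfl
  · exact absurd rfl g2.ne
  · exact key F.bc
  · exact g3
  · exact key F.cd.symm

/-- `z` has exactly five neighbours, which induce a cycle in the given order. -/
structure FiveWheel (G : SimpleGraph V) (z r₀ r₁ r₂ r₃ r₄ : V) : Prop where
  z0 : G.Adj z r₀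
  z1 : G.Adj z r₁
  z2 : G.Adj z r₂
  z3 : G.Adj z r₃
  z4 : G.Adj z r₄
  a01 : G.Adj r₀ r₁
  a12 : G.Adj r₁ r₂
  a23 : G.Adj r₂ r₃
  a34 : G.Adj r₃ r₄
  a40 : G.Adj r₄ r₀
  n02 : ¬ G.Adj r₀ r₂
  n13 : ¬ G.Adj r₁ r₃
  n24 : ¬ G.Adj r₂ r₄
  n30 : ¬ G.Adj r₃ r₀
  n41 : ¬ G.Adj r₄ r₁
  nbr : ∀ t, G.Adj z t → t = r₀ ∨ t = r₁ ∨ t = r₂ ∨ t = r₃ ∨ t = r₄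

theorem FiveWheel.reflect (W : FiveWheel G z r₀ r₁ r₂ r₃ r₄) : FiveWheel G z r₀ r₄ r₃ r₂ r₁ :=
  ⟨W.z0, W.z4, W.z3, W.z2, W.z1, W.a40.symm, W.a34.symm, W.a23.symm, W.a12.symm, W.a01.symm,
    fun e => W.n30 e.symm, fun e => W.n24 e.symm, fun e => W.n13 e.symm, fun e => W.n02 e.symm,
    fun e => W.n41 e.symm, fun t ht => by have := W.nbr t ht; tauto⟩

theorem FiveWheel.common (W : FiveWheel G z r₀ r₁ r₂ r₃ r₄) (t : V) (hz : G.Adj z t)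
    (ht : G.Adj r₀ t) : t = r₁ ∨ t = r₄ := by
  rcases W.nbr t hz with rfl | rfl | rfl | rfl | rfl
  · exact absurd rfl ht.ne
  · exact .inl rfl
  · exact absurd ht W.n02
  · exact absurd ht.symm W.n30
  · exact .inr rfl

theorem FiveWheel.rotate (W : FiveWheel G z r₀ r₁ r₂ r₃ r₄) : FiveWheel G z r₁ r₂ r₃ r₄ r₀ :=
  ⟨W.z1, W.z2, W.z3, W.z4, W.z0, W.a12, W.a23, W.a34, W.a40, W.a01, W.n13, W.n24, W.n30, W.n41,
    W.n02, fun t ht => by have := W.nbr t ht; tauto⟩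

theorem FiveWheel.ne (W : FiveWheel G z r₀ r₁ r₂ r₃ r₄) : r₁ ≠ r₄ :=
  fun e => W.n24 (e ▸ W.a12.symm)

variable [Fintype V] [DecidableRel G.Adj]

theorem exists_adj_not_mem (l : List V) (hl : l.length < G.degree v) :
    ∃ t, G.Adj v t ∧ t ∉ l := by
  classical
  by_contra hc
  push Not at hc
  have : G.neighborFinset v ⊆ l.toFinset := fun t ht => by
    simpa using hc t (by simpa using ht)
  have := (Finset.card_le_card this).trans l.toFinset_card_le
  rw [card_neighborFinset_eq_degree] at this
  omega

theorem FourWheel.outer_unique (F : FourWheel G v a b c d) (hd : G.degree a ≤ 4) {s t : V}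
    (hs : G.Adj a s) (ht : G.Adj a t) (hsv : s ≠ v) (hsv' : ¬ G.Adj s v) (htv : t ≠ v)
    (htv' : ¬ G.Adj t v) : s = t := by
  have e1 := F.vb.ne
  have e2 := F.vd.ne
  have e3 := F.bd
  have e4 : s ≠ b := fun e => hsv' (e ▸ F.vb.symm)
  have e5 : s ≠ d := fun e => hsv' (e ▸ F.vd.symm)
  have e6 : t ≠ b := fun e => htv' (e ▸ F.vb.symm)
  have e7 : t ≠ d := fun e => htv' (e ▸ F.vd.symm)
  have := mem_of_degree_le [v, b, d, s] (by grind)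
    (by simp [F.va.symm, F.ab, F.da.symm, hs]) (by simpa using hd) ht
  simp only [List.mem_cons, List.not_mem_nil, or_false] at this
  grind

/-- A degree-four rim vertex has one outside neighbour. So the outer common neighbours of `ab` and
of `bc` coincide with the outside neighbour of `a`, which should miss `c` because of the edge `vc`.
-/
theorem FourWheel.not_le_adjacent (h : Sat G) (F : FourWheel G v a b c d) (ha : G.degree a ≤ 4)
    (hb : G.degree b ≤ 4) : False := by
  obtain ⟨s, s1, s2, s3, s4⟩ := F.rotate.rotate.exists_outer_opp h
  obtain ⟨y, y1, y2, y3, y4⟩ := F.exists_outer_edge h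
  obtain ⟨x, x1, x2, x3, x4⟩ := F.rotate.exists_outer_edge h
  have e1 := F.outer_unique ha s1 y1 s2 s3 y3 y4
  have e2 := F.rotate.outer_unique hb y2 x1 y3 y4 x3 x4
  subst e1 e2
  exact s4 x2.symm

/-- The outside neighbours of `a` and of `c` both see `b` and `d`, and `b` has a further one missing
`d`. So `b`, and likewise `d`, has degree six. -/
theorem FourWheel.not_le_opposite (T : Tight G) (F : FourWheel G v a b c d)
    (ha : G.degree a ≤ 4) (hc : G.degree c ≤ 4) : False := by
  have h := T.sat
  have six : ∀ {b d : V}, FourWheel G v a b c d → 6 ≤ G.degree b := by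
    intro b d F
    obtain ⟨s, s1, s2, s3, s4⟩ := F.exists_outer_opp h
    obtain ⟨r, r1, r2, r3, r4⟩ := F.rotate.rotate.exists_outer_opp h
    obtain ⟨u, u1, u2, u3, u4⟩ := F.rotate.rotate.rotate.exists_outer_opp h
    obtain ⟨y, y1, y2, y3, y4⟩ := F.exists_outer_edge h
    obtain ⟨x, x1, x2, x3, x4⟩ := F.rotate.exists_outer_edge h
    obtain ⟨w, w1, w2, w3, w4⟩ := F.rotate.rotate.exists_outer_edge h
    obtain ⟨p, p1, p2, p3, p4⟩ := F.rotate.rotate.rotate.exists_outer_edge h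
    have e1 := F.outer_unique ha r1 y1 r2 r3 y3 y4
    have e2 := F.outer_unique ha r1 p2 r2 r3 p3 p4
    have e3 := F.rotate.rotate.outer_unique hc s1 x2 s2 s3 x3 x4
    have e4 := F.rotate.rotate.outer_unique hc s1 w1 s2 s3 w3 w4
    subst e1 e2 e3 e4
    have f1 : r ≠ s := fun e => r4 (e ▸ s1.symm)
    have f2 : u ≠ r := fun e => u4 (e ▸ p1.symm)
    have f3 : u ≠ s := fun e => u4 (e ▸ w2.symm)
    have f4 := F.va.ne
    have f5 := F.vc.ne
    have f6 := F.ac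
    have key : ∀ {t}, ¬ G.Adj t v → t ≠ a ∧ t ≠ c := fun ht =>
      ⟨fun e => ht (e ▸ F.va.symm), fun e => ht (e ▸ F.vc.symm)⟩
    have k1 := key s3
    have k2 := key r3
    have k3 := key u3
    exact length_le_degree [v, a, c, s, r, u] (by clear key; grind)
      (by simp [F.vb.symm, F.ab.symm, F.bc, x1, y2, u1])
  have hb := six F
  have hd : 6 ≤ G.degree d := six (b := d) (d := b)
    ⟨F.va, F.vd, F.vc, F.vb, F.da.symm, F.cd.symm, F.bc.symm, F.ab.symm, F.nac,
      fun e => F.nbd e.symm, F.ac, F.bd.symm, fun t ht => by have := F.nbr t ht; tauto⟩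
  have := T.two F.bd hb
  omega

theorem Tight.no_fourWheel (T : Tight G) (F : FourWheel G v a b c d) : False := by
  have h := T.sat
  by_cases ha : G.degree a ≤ 4
  · have hb : 5 ≤ G.degree b := by
      by_contra hb
      exact F.not_le_adjacent h ha (by omega)
    have hc : 5 ≤ G.degree c := by
      by_contra hc
      exact F.not_le_opposite T ha (by omega)
    have hd : 5 ≤ G.degree d := by
      by_contra hd
      exact F.rotate.rotate.rotate.not_le_adjacent h (by omega) ha
    exact T.three F.bc.ne F.bd F.cd.ne hb hc hd
  · by_cases hb : G.degree b ≤ 4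
    · have hc : 5 ≤ G.degree c := by
        by_contra hc
        exact F.rotate.not_le_adjacent h hb (by omega)
      have hd : 5 ≤ G.degree d := by
        by_contra hd
        exact F.rotate.not_le_opposite T hb (by omega)
      exact T.three F.ac F.da.ne.symm F.cd.ne (by omega) hc hd
    · by_cases hc : G.degree c ≤ 4
      · have hd : 5 ≤ G.degree d := by
          by_contra hd
          exact F.rotate.rotate.not_le_adjacent h hc (by omega)
        exact T.three F.ab.ne F.da.ne.symm F.bd (by omega) (by omega) hd
      · exact T.three F.ab.ne F.ac F.bc.ne (by omega) (by omega) (by omega)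

/-- The fourth neighbour `a` sees three, two, one or none of `b`, `c`, `d`: a clique neighbourhood,
a diamond, a paw, or an edge `va` without common neighbour. -/
theorem Tight.no_triangle (T : Tight G) (hd4 : G.degree v ≤ 4) (hvb : G.Adj v b)
    (hvc : G.Adj v c) (hvd : G.Adj v d) (hbc : G.Adj b c) (hbd : G.Adj b d) (hcd : G.Adj c d) :
    False := by
  have hpos := degree_pos_of_adj hvb
  obtain ⟨a, hva, ha⟩ := exists_adj_not_mem (G := G) (v := v) [b, c, d]
    (Nat.lt_of_succ_le (T.four v hpos))
  have ha' : a ≠ b ∧ a ≠ c ∧ a ≠ d := by simpa using ha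
  obtain ⟨nab, nac, nad⟩ := ha'
  have e1 := hbc.ne
  have e2 := hbd.ne
  have e3 := hcd.ne
  have hN : ∀ t, G.Adj v t → t = a ∨ t = b ∨ t = c ∨ t = d := fun t ht => by
    simpa using mem_of_degree_le [a, b, c, d] (by grind) (by simp [hva, hvb, hvc, hvd])
      (by simpa using hd4) ht
  have perm : ∀ {p q r : V}, (∀ t, t = a ∨ t = b ∨ t = c ∨ t = d ↔ t = a ∨ t = p ∨ t = q ∨ t = r) →
      ∀ t, G.Adj v t → t = a ∨ t = p ∨ t = q ∨ t = r := fun hp t ht => (hp t).1 (hN t ht)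
  by_cases hab : G.Adj a b <;> by_cases hac : G.Adj a c <;> by_cases had : G.Adj a d
  · obtain ⟨p, q, g1, g2, g3, g4⟩ := T.ns v hpos
    rcases hN p g1 with rfl | rfl | rfl | rfl <;> rcases hN q g2 with rfl | rfl | rfl | rfl <;>
      first
      | exact g3 rfl
      | exact g4 (by first | assumption | (apply SimpleGraph.Adj.symm; assumption))
  · exact T.no_diamond hva hvb hvc hvd hab hac hbc hbd hcd had nad hN
  · exact T.no_diamond hva hvb hvd hvc hab had hbd hbc hcd.symm hac nac (perm (by tauto))
  · exact T.no_paw hvc hvd hvb.symm hab.symm hbc hbd hcd hva.symm hac nac had nad hN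
  · exact T.no_diamond hva hvc hvd hvb hac had hcd hbc.symm hbd.symm hab nab (perm (by tauto))
  · exact T.no_paw hvb hvd hvc.symm hac.symm hbc.symm hcd hbd hva.symm hab nab had nad
      (perm (by tauto))
  · exact T.no_paw hvb hvc hvd.symm had.symm hbd.symm hcd.symm hbc hva.symm hab nab hac nac
      (perm (by tauto))
  · obtain ⟨p, g1, g2⟩ := T.sat.exists_common hva
    rcases hN p g1.symm with rfl | rfl | rfl | rfl
    · exact g2.ne rfl
    · exact hab g2.symm
    · exact hac g2.symm
    · exact had g2.symm

theorem Tight.no_K4 (T : Tight G) (hab : G.Adj a b) (hac : G.Adj a c) (had : G.Adj a d)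
    (hbc : G.Adj b c) (hbd : G.Adj b d) (hcd : G.Adj c d) : False := by
  by_cases ha : G.degree a ≤ 4
  · exact T.no_triangle ha hab hac had hbc hbd hcd
  by_cases hb : G.degree b ≤ 4
  · exact T.no_triangle hb hab.symm hbc hbd hac had hcd
  by_cases hc : G.degree c ≤ 4
  · exact T.no_triangle hc hac.symm hbc.symm hcd hab had hbd
  exact T.three hab.ne hac.ne hbc.ne (by omega) (by omega) (by omega)

/-- The neighbourhood of `z` has no triangle by `no_K4` and no three independent vertices. This is
the extremal case of R(3,3) = 6: at most five vertices, and with five only the 5-cycle. -/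
theorem Tight.exists_fiveWheel (T : Tight G) (hz : 5 ≤ G.degree z) (h0 : G.Adj z r₀) :
    ∃ r₁ r₂ r₃ r₄, FiveWheel G z r₀ r₁ r₂ r₃ r₄ := by
  classical
  have h := T.sat
  set P := (G.neighborFinset z).filter (fun t => G.Adj r₀ t)
  set Q := (G.neighborFinset z).filter (fun t => t ≠ r₀ ∧ ¬ G.Adj t r₀)
  have hP : P.card ≤ 2 := by
    by_contra hc
    obtain ⟨p, hp, q, hq, r, hr, hpq, hpr, hqr⟩ := Finset.two_lt_card.1 (not_le.1 hc)
    simp only [P, Finset.mem_filter, mem_neighborFinset] at hp hq hr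
    by_cases e1 : G.Adj p q
    · exact T.no_K4 h0 hp.1 hq.1 hp.2 hq.2 e1
    by_cases e2 : G.Adj p r
    · exact T.no_K4 h0 hp.1 hr.1 hp.2 hr.2 e2
    exact T.no_K4 h0 hq.1 hr.1 hq.2 hr.2 (h.free z p q r hp.1 hq.1 hr.1 hpq hpr hqr e1 e2)
  have hQ : Q.card ≤ 2 := by
    by_contra hc
    obtain ⟨p, hp, q, hq, r, hr, hpq, hpr, hqr⟩ := Finset.two_lt_card.1 (not_le.1 hc)
    simp only [Q, Finset.mem_filter, mem_neighborFinset] at hp hq hr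
    exact T.no_K4 hp.1 hq.1 hr.1 (Far.adj h h0.symm hp hq hpq) (Far.adj h h0.symm hp hr hpr)
      (Far.adj h h0.symm hq hr hqr)
  have hU : G.neighborFinset z ⊆ insert r₀ (P ∪ Q) := by
    intro t ht
    simp only [P, Q, Finset.mem_insert, Finset.mem_union, Finset.mem_filter]
    by_cases e1 : t = r₀
    · exact .inl e1
    by_cases e2 : G.Adj r₀ t
    · exact .inr (.inl ⟨ht, e2⟩)
    · exact .inr (.inr ⟨ht, e1, fun e => e2 e.symm⟩)
  have hcard := Finset.card_le_card hU
  rw [card_neighborFinset_eq_degree] at hcard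
  have h1 := Finset.card_insert_le r₀ (P ∪ Q)
  have h2 := Finset.card_union_le P Q
  obtain ⟨r₁, r₄, h14, hPe⟩ := Finset.card_eq_two.1 (show P.card = 2 by omega)
  obtain ⟨r₂, r₃, h23, hQe⟩ := Finset.card_eq_two.1 (show Q.card = 2 by omega)
  have m1 : r₁ ∈ P := by simp [hPe]
  have m4 : r₄ ∈ P := by simp [hPe]
  have m2 : r₂ ∈ Q := by simp [hQe]
  have m3 : r₃ ∈ Q := by simp [hQe]
  have hN : ∀ t, G.Adj z t → t = r₀ ∨ t = r₁ ∨ t = r₂ ∨ t = r₃ ∨ t = r₄ := by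
    intro t ht
    have := hU (by simpa using ht)
    rw [hPe, hQe] at this
    simp only [Finset.mem_insert, Finset.mem_union, Finset.mem_singleton] at this
    tauto
  simp only [P, Q, Finset.mem_filter, mem_neighborFinset] at m1 m2 m3 m4
  have a23 := Far.adj h h0.symm m2 m3 h23
  have n14 : ¬ G.Adj r₁ r₄ := fun e => T.no_K4 h0 m1.1 m4.1 m1.2 m4.2 e
  have ne : ∀ {p q}, G.Adj r₀ p → ¬ G.Adj q r₀ → p ≠ q := fun hp hq e => hq (e ▸ hp.symm)
  have build : ∀ {r₂ r₃ : V}, (G.Adj z r₂ ∧ r₂ ≠ r₀ ∧ ¬ G.Adj r₂ r₀) →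
      (G.Adj z r₃ ∧ r₃ ≠ r₀ ∧ ¬ G.Adj r₃ r₀) → G.Adj r₂ r₃ →
      (∀ t, G.Adj z t → t = r₀ ∨ t = r₁ ∨ t = r₂ ∨ t = r₃ ∨ t = r₄) → G.Adj r₁ r₂ →
      FiveWheel G z r₀ r₁ r₂ r₃ r₄ := by
    intro r₂ r₃ m2 m3 a23 hN a12
    have n13 : ¬ G.Adj r₁ r₃ := fun e => T.no_K4 m1.1 m2.1 m3.1 a12 e a23
    have a34 : G.Adj r₃ r₄ := h.free z r₁ r₃ r₄ m1.1 m3.1 m4.1 (ne m1.2 m3.2.2) h14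
      (ne m4.2 m3.2.2).symm n13 n14
    have n24 : ¬ G.Adj r₂ r₄ := fun e => T.no_K4 m2.1 m3.1 m4.1 a23 e a34
    exact ⟨h0, m1.1, m2.1, m3.1, m4.1, m1.2, a12, a23, a34, m4.2.symm, fun e => m2.2.2 e.symm,
      n13, n24, m3.2.2, fun e => n14 e.symm, hN⟩
  by_cases a12 : G.Adj r₁ r₂
  · exact ⟨r₁, r₂, r₃, r₄, build m2 m3 a23 hN a12⟩
  by_cases a13 : G.Adj r₁ r₃
  · exact ⟨r₁, r₃, r₂, r₄, build m3 m2 a23.symm (fun t ht => by have := hN t ht; tauto) a13⟩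
  exfalso
  have f2 : Far G r₁ z r₂ := ⟨m2.1, (ne m1.2 m2.2.2).symm, fun e => a12 e.symm⟩
  have f3 : Far G r₁ z r₃ := ⟨m3.1, (ne m1.2 m3.2.2).symm, fun e => a13 e.symm⟩
  have f4 : Far G r₁ z r₄ := ⟨m4.1, h14.symm, fun e => n14 e.symm⟩
  exact T.no_K4 m2.1 m3.1 m4.1 a23 (Far.adj h m1.1.symm f2 f4 (ne m4.2 m2.2.2).symm)
    (Far.adj h m1.1.symm f3 f4 (ne m4.2 m3.2.2).symm)

/-- A degree-four rim vertex `r` of a wheel with hub `z` has a single neighbour outside the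
wheel, which is adjacent to exactly one of the two rim neighbours `p`, `n` of `r`. -/
theorem Tight.rim (T : Tight G) {r p n : V} (hr : G.Adj z r) (hp : G.Adj z p) (hn : G.Adj z n)
    (hrp : G.Adj r p) (hrn : G.Adj r n) (hpn : ¬ G.Adj p n) (hpn' : p ≠ n)
    (hz : ∀ t, G.Adj z t → G.Adj r t → t = p ∨ t = n) (hd : G.degree r ≤ 4) :
    ∃ q, G.Adj r q ∧ ¬ G.Adj z q ∧ (∀ t, G.Adj r t → t = z ∨ t = p ∨ t = n ∨ t = q) ∧
      (G.Adj q p ∧ ¬ G.Adj q n ∨ ¬ G.Adj q p ∧ G.Adj q n) := by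
  obtain ⟨q, hrq, hq⟩ := exists_adj_not_mem (G := G) (v := r) [z, p, n]
    (Nat.lt_of_succ_le (T.four r (degree_pos_of_adj hrp)))
  have hq' : q ≠ z ∧ q ≠ p ∧ q ≠ n := by simpa using hq
  obtain ⟨q1, q2, q3⟩ := hq'
  have hzq : ¬ G.Adj z q := fun e => by have := hz q e hrq; tauto
  have e1 := hp.ne
  have e2 := hn.ne
  have hN : ∀ t, G.Adj r t → t = z ∨ t = p ∨ t = n ∨ t = q := fun t ht => by
    simpa using mem_of_degree_le [z, p, n, q] (by clear hz; grind)
      (by simp [hr.symm, hrp, hrn, hrq]) (by simpa using hd) ht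
  refine ⟨q, hrq, hzq, hN, ?_⟩
  -- Seeing both would make the neighbourhood of `r` a 4-cycle; seeing neither would leave `rq`
  -- without a common neighbour.
  by_cases g1 : G.Adj q p <;> by_cases g2 : G.Adj q n
  · exact (T.no_fourWheel (v := r) (a := p) (b := z) (c := n) (d := q)
      ⟨hrp, hr.symm, hrn, hrq, hp.symm, hn, g2.symm, g1, hpn, hzq, hpn', q1.symm,
        fun t ht => by have := hN t ht; tauto⟩).elim
  · exact .inl ⟨g1, g2⟩
  · exact .inr ⟨g1, g2⟩
  · obtain ⟨s, s1, s2⟩ := T.sat.exists_common hrq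
    rcases hN s s1.symm with rfl | rfl | rfl | rfl
    · exact absurd s2 hzq
    · exact absurd s2.symm g1
    · exact absurd s2.symm g2
    · exact absurd rfl s2.ne

theorem Tight.rim_wheel (T : Tight G) (W : FiveWheel G z r₀ r₁ r₂ r₃ r₄)
    (hd : G.degree r₀ ≤ 4) : ∃ q, G.Adj r₀ q ∧ ¬ G.Adj z q ∧
      (∀ t, G.Adj r₀ t → t = z ∨ t = r₁ ∨ t = r₄ ∨ t = q) ∧
      (G.Adj q r₁ ∧ ¬ G.Adj q r₄ ∨ ¬ G.Adj q r₁ ∧ G.Adj q r₄) :=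
  T.rim W.z0 W.z1 W.z4 W.a01 W.a40.symm (fun e => W.n41 e.symm) W.ne W.common hd

/-- Outside neighbours pair up along the rim: `t` is shared by `r₁`, `r₂`, and another vertex by
`r₃`, `r₄`, neither seeing `r₀`. So an outside neighbour of `r₀` misses `r₁` and `r₄`, contrary to
`rim_wheel` if `r₀` has degree four and to its own five-wheel otherwise. -/
theorem Tight.no_wheel_of_center (T : Tight G) (hz : 5 ≤ G.degree z)
    (W : FiveWheel G z r₀ r₁ r₂ r₃ r₄) (d1 : G.degree r₁ ≤ 4) (d2 : G.degree r₂ ≤ 4)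
    (d3 : G.degree r₃ ≤ 4) (d4 : G.degree r₄ ≤ 4) {t : V} (h1 : G.Adj r₁ t) (h2 : t ≠ z)
    (h3 : ¬ G.Adj t z) (h4 : t ≠ r₀) (h5 : ¬ G.Adj t r₀) : False := by
  have h := T.sat
  obtain ⟨q₁, a1, b1, c1, e1⟩ := T.rim_wheel W.rotate d1
  obtain ⟨q₂, a2, b2, c2, e2⟩ := T.rim_wheel W.rotate.rotate d2
  obtain ⟨q₃, a3, b3, c3, e3⟩ := T.rim_wheel W.rotate.rotate.rotate d3
  obtain ⟨q₄, a4, b4, c4, e4⟩ := T.rim_wheel W.rotate.rotate.rotate.rotate d4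
  have ht : t = q₁ := by
    rcases c1 t h1 with rfl | rfl | rfl | rfl
    · exact absurd rfl h2
    · exact absurd W.z2.symm h3
    · exact absurd rfl h4
    · rfl
  subst ht
  have ht2 : G.Adj t r₂ := by tauto
  have hq2 : t = q₂ := by
    rcases c2 t ht2.symm with rfl | rfl | rfl | rfl
    · exact absurd rfl h2
    · exact absurd W.z3 b1
    · exact absurd W.z1 b1
    · rfl
  subst hq2
  have hq3 : ¬ G.Adj q₃ r₂ := by
    intro e
    rcases c2 q₃ e.symm with rfl | rfl | rfl | rfl
    · rcases e3 with e3 | e3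
      · exact e3.2 e
      · exact e3.1 W.z4
    · exact a3.ne rfl
    · exact W.n13 a3.symm
    · have := a1.symm
      have := a3.symm
      tauto
  have hq34 : G.Adj q₃ r₄ := by tauto
  have hq4 : q₃ = q₄ := by
    rcases c4 q₃ hq34.symm with rfl | rfl | rfl | rfl
    · exact absurd W.z2 hq3
    · exact absurd W.z0 b3
    · exact absurd rfl a3.ne
    · rfl
  subst hq4
  have hq40 : ¬ G.Adj q₃ r₀ := by
    have := a3.symm
    tauto
  have outer : ∀ {o : V}, G.Adj r₀ o → ¬ G.Adj z o → o ≠ z → ¬ G.Adj o r₁ ∧ ¬ G.Adj o r₄ := by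
    intro o ho hzo hoz
    refine ⟨fun e => ?_, fun e => ?_⟩
    · rcases c1 o e.symm with rfl | rfl | rfl | rfl
      · exact hoz rfl
      · exact hzo W.z2
      · exact ho.ne rfl
      · exact h5 ho.symm
    · rcases c4 o e.symm with rfl | rfl | rfl | rfl
      · exact hoz rfl
      · exact ho.ne rfl
      · exact hzo W.z3
      · exact hq40 ho.symm
  by_cases d0 : G.degree r₀ ≤ 4
  · obtain ⟨q₀, a0, b0, c0, e0⟩ := T.rim_wheel W d0
    have hq0 : q₀ ≠ z := by
      rintro rfl
      rcases e0 with e0 | e0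
      · exact e0.2 W.z4
      · exact e0.1 W.z1
    have := outer a0 b0 hq0
    tauto
  · obtain ⟨s₁, s₂, s₃, s₄, W'⟩ := T.exists_fiveWheel (z := r₀) (r₀ := z) (by omega) W.z0.symm
    have ho := outer W'.z2 W'.n02 (fun e => W'.n24 (e ▸ W'.a40.symm))
    rcases W.common s₁ W'.a01 W'.z1 with e | e
    · exact ho.1 (e ▸ W'.a12.symm)
    · exact ho.2 (e ▸ W'.a12.symm)

theorem Tight.degree_le_four (T : Tight G) : G.degree z ≤ 4 := by
  by_contra hc
  have hz : 5 ≤ G.degree z := by omega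
  have h := T.sat
  -- At most one rim vertex can have degree above four; the labelling puts it at `r₀`.
  obtain ⟨r₀, h0, hr₀⟩ : ∃ r₀, G.Adj z r₀ ∧ ∀ r, G.Adj z r → r ≠ r₀ → G.degree r ≤ 4 := by
    by_cases hex : ∃ r, G.Adj z r ∧ 5 ≤ G.degree r
    · obtain ⟨r₀, h0, hd⟩ := hex
      refine ⟨r₀, h0, fun r hr hne => ?_⟩
      by_contra hc'
      exact T.three h0.ne hr.ne hne.symm hz hd (by omega)
    · push Not at hex
      obtain ⟨r₀, h0⟩ := (G.degree_pos_iff_exists_adj z).1 (by omega)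
      exact ⟨r₀, h0, fun r hr _ => by have := hex r hr; omega⟩
  obtain ⟨r₁, r₂, r₃, r₄, W⟩ := T.exists_fiveWheel hz h0
  have d1 := hr₀ r₁ W.z1 W.a01.ne.symm
  have d2 := hr₀ r₂ W.z2 (fun e => W.n30 (e ▸ W.a23.symm))
  have d3 := hr₀ r₃ W.z3 (fun e => W.n02 (e ▸ W.a23.symm))
  have d4 := hr₀ r₄ W.z4 W.a40.ne
  obtain ⟨p, t, g1, g2, g3, g4, g5, g6, g7⟩ := h.rem z r₀ h0
  rcases W.common p g1.symm g2.symm with rfl | rfl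
  · exact T.no_wheel_of_center hz W d1 d2 d3 d4 g3 g4 g6 g5 g7
  · exact T.no_wheel_of_center hz W.reflect d4 d3 d2 d1 g3 g4 g6 g5 g7

end

/-! ### Odd triangles and divisibility by three -/

section

variable {V : Type*} {G : SimpleGraph V} {v a b c d : V}

/-- The neighbours of `v` are `a`, `b`, `c`, `d`; they induce two disjoint edges `ab`, `cd` or a
path with these end edges. -/
structure Quad (G : SimpleGraph V) (v a b c d : V) : Prop where
  va : G.Adj v a
  vb : G.Adj v b
  vc : G.Adj v c
  vd : G.Adj v d
  ab : G.Adj a b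
  cd : G.Adj c d
  nac : ¬ G.Adj a c
  nad : ¬ G.Adj a d
  nbd : ¬ G.Adj b d
  nbr : ∀ t, G.Adj v t → t = a ∨ t = b ∨ t = c ∨ t = d

/-- Some vertex is adjacent to exactly one vertex of `t`. -/
def Odd (G : SimpleGraph V) (t : Finset V) : Prop :=
  ∃ u x, x ∈ t ∧ G.Adj u x ∧ ∀ y ∈ t, G.Adj u y → y = x

theorem Quad.ne (Q : Quad G v a b c d) : a ≠ c ∧ a ≠ d ∧ b ≠ c ∧ b ≠ d :=
  ⟨fun e => Q.nad (e ▸ Q.cd), fun e => Q.nac (e ▸ Q.cd.symm), fun e => Q.nac (e ▸ Q.ab),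
    fun e => Q.nad (e ▸ Q.ab)⟩

theorem exists_eq_of_isNClique [DecidableEq V] {t : Finset V} (ht : G.IsNClique 3 t)
    (hv : v ∈ t) : ∃ p q, G.Adj v p ∧ G.Adj v q ∧ G.Adj p q ∧ t = {v, p, q} := by
  obtain ⟨x, y, z, hxy, hxz, hyz, rfl⟩ := is3Clique_iff.1 ht
  simp only [Finset.mem_insert, Finset.mem_singleton] at hv
  rcases hv with rfl | rfl | rfl
  · exact ⟨y, z, hxy, hxz, hyz, rfl⟩
  · exact ⟨x, z, hxy.symm, hyz, hxz, by ext; simp; tauto⟩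
  · exact ⟨x, y, hxz.symm, hyz.symm, hxy, by ext; simp; tauto⟩

variable [Fintype V] [DecidableRel G.Adj]

/-- The four neighbours induce no triangle, no 4-cycle, no star by claw-freeness, and no isolated
vertex by `exists_common`. Two disjoint edges or a path remain. -/
theorem Tight.exists_quad (T : Tight G) (hv : 0 < G.degree v) : ∃ a b c d, Quad G v a b c d := by
  have h := T.sat
  have hd := T.degree_le_four (z := v)
  obtain ⟨p, q, hp, hq, hpq, npq⟩ := T.ns v hv
  have fin : ∀ {r s : V}, G.Adj v r → G.Adj v s → G.Adj p r → G.Adj q s → r ≠ s →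
      ∃ a b c d, Quad G v a b c d := by
    intro r s hr hs hpr hqs hrs
    have e1 : r ≠ q := fun e => npq (e ▸ hpr)
    have e2 : s ≠ p := fun e => npq (e ▸ hqs.symm)
    have e3 := hpr.ne
    have e4 := hqs.ne
    have hN : ∀ t, G.Adj v t → t = p ∨ t = r ∨ t = s ∨ t = q := fun t ht => by
      simpa using mem_of_degree_le [p, r, s, q] (by grind) (by simp [hp, hr, hs, hq])
        (by simpa using hd) ht
    by_cases hps : G.Adj p s
    · have nrs : ¬ G.Adj r s := fun e => T.no_triangle hd hp hr hs hpr hps e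
      have nrq : ¬ G.Adj r q := fun e => T.no_fourWheel (v := v) (a := p) (b := r) (c := q) (d := s)
        ⟨hp, hr, hq, hs, hpr, e, hqs, hps.symm, npq, nrs, hpq, hrs,
          fun t ht => by have := hN t ht; tauto⟩
      exact ⟨r, p, s, q, hr, hp, hs, hq, hpr.symm, hqs.symm, nrs, nrq, npq,
        fun t ht => by have := hN t ht; tauto⟩
    by_cases hrq : G.Adj r q
    · have nrs : ¬ G.Adj r s := fun e => T.no_triangle hd hr hq hs hrq e hqs
      exact ⟨p, r, q, s, hp, hr, hq, hs, hpr, hqs, npq, hps, nrs,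
        fun t ht => by have := hN t ht; tauto⟩
    exact ⟨p, r, s, q, hp, hr, hs, hq, hpr, hqs.symm, hps, npq, hrq, hN⟩
  obtain ⟨r, r1, r2⟩ := h.exists_common hp
  obtain ⟨s, s1, s2⟩ := h.exists_common hq
  by_cases hrs : r = s
  · subst hrs
    obtain ⟨m, hm, hml⟩ := exists_adj_not_mem (G := G) (v := v) [p, r, q]
      (Nat.lt_of_succ_le (T.four v hv))
    have hm' : m ≠ p ∧ m ≠ r ∧ m ≠ q := by simpa using hml
    by_cases hpm : G.Adj p m
    · exact fin hm s1.symm hpm s2.symm hm'.2.1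
    · exact fin r1.symm hm r2.symm
        (h.free v p q m hp hq hm hpq hm'.1.symm hm'.2.2.symm npq hpm) hm'.2.1.symm
  · exact fin r1.symm s1.symm r2.symm s2.symm hrs

/-- Degrees are four, so the fourth neighbour `s` of `b` is the third leaf for `va`, and
claw-freeness at `b` makes it see `c`; the same holds with `b` and `c` exchanged. Every vertex that
sees the triangle then sees at least two of its vertices. -/
theorem Quad.not_odd_middle [DecidableEq V] (T : Tight G) (Q : Quad G v a b c d)
    (hbc : G.Adj b c) : ¬ Odd G {v, b, c} := by
  have h := T.sat
  have exists_outer : ∀ {a b c d : V}, Quad G v a b c d → G.Adj b c →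
      ∃ s, G.Adj b s ∧ G.Adj s c ∧ ∀ t, G.Adj b t → t = a ∨ t = v ∨ t = c ∨ t = s := by
    intro a b c d Q hbc
    obtain ⟨p, s, g1, g2, g3, g4, g5, g6, g7⟩ := h.rem v a Q.va
    have hpb : p = b := by
      rcases Q.nbr p g1.symm with rfl | rfl | rfl | rfl
      · exact absurd rfl g2.ne
      · rfl
      · exact absurd g2.symm Q.nac
      · exact absurd g2.symm Q.nad
    subst hpb
    have e1 : s ≠ c := fun e => g6 (e ▸ Q.vc.symm)
    have e2 := Q.va.ne
    have e3 := Q.vc.ne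
    have e4 := Q.ne.1
    have hsc := h.free p a s c g2 g3 hbc g5.symm e4 e1 (fun e => g7 e.symm) Q.nac
    refine ⟨s, g3, hsc, fun t ht => ?_⟩
    simpa using mem_of_degree_le [a, v, c, s] (by grind) (by simp [g1, g2, g3, hbc])
      (by simpa using T.degree_le_four) ht
  have Q' : Quad G v d c b a := ⟨Q.vd, Q.vc, Q.vb, Q.va, Q.cd.symm, Q.ab.symm,
    fun e => Q.nbd e.symm, fun e => Q.nad e.symm, fun e => Q.nac e.symm,
    fun t ht => by have := Q.nbr t ht; tauto⟩
  obtain ⟨s, s1, s2, s3⟩ := exists_outer Q hbc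
  obtain ⟨r, r1, r2, r3⟩ := exists_outer Q' hbc.symm
  have e1 := Q.vb.ne
  have e2 := Q.vc.ne
  have e3 := hbc.ne
  rintro ⟨u, x, hx, hux, hu⟩
  simp only [Finset.mem_insert, Finset.mem_singleton] at hx hu
  have hv := hu v (.inl rfl)
  have hb := hu b (.inr (.inl rfl))
  have hc := hu c (.inr (.inr rfl))
  rcases hx with rfl | rfl | rfl
  · rcases Q.nbr u hux.symm with rfl | rfl | rfl | rfl
    · exact e1 (hb Q.ab).symm
    · exact e2 (hc hbc).symm
    · exact e1 (hb hbc.symm).symm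
    · exact e2 (hc Q.cd.symm).symm
  · rcases s3 u hux.symm with rfl | rfl | rfl | rfl
    · exact e1 (hv Q.va.symm)
    · exact e3 (hc Q.vc).symm
    · exact e1 (hv Q.vc.symm)
    · exact e3 (hc s2).symm
  · rcases r3 u hux.symm with rfl | rfl | rfl | rfl
    · exact e2 (hv Q.vd.symm)
    · exact e3 (hb Q.vb)
    · exact e2 (hv Q.vb.symm)
    · exact e3 (hb r2)

-- The end edges `ab` and `cd` give odd triangles, witnessed by `d` and `a`. A middle edge `bc`
-- gives one that is not odd.
open Classical in
theorem Quad.card_odd_triangles (T : Tight G) (Q : Quad G v a b c d) :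
    (((G.cliqueFinset 3).filter (Odd G)).filter (v ∈ ·)).card = 2 := by
  rw [Finset.card_eq_two]
  have hne := Q.ne
  refine ⟨{v, a, b}, {v, c, d}, ?_, ?_⟩
  · intro e
    have : a ∈ ({v, c, d} : Finset V) := e ▸ (by simp)
    simp only [Finset.mem_insert, Finset.mem_singleton] at this
    rcases this with e | e | e
    exacts [Q.va.ne e.symm, hne.1 e, hne.2.1 e]
  · ext t
    simp only [Finset.mem_filter, mem_cliqueFinset_iff, Finset.mem_insert, Finset.mem_singleton]
    constructor
    · rintro ⟨⟨ht, hodd⟩, hv⟩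
      obtain ⟨p, q, hp, hq, hpq, rfl⟩ := exists_eq_of_isNClique ht hv
      have swap : ∀ p q : V, ({v, p, q} : Finset V) = {v, q, p} := fun p q => by
        rw [Finset.pair_comm]
      have npp := hpq.ne
      rcases Q.nbr p hp with rfl | rfl | rfl | rfl <;>
        rcases Q.nbr q hq with rfl | rfl | rfl | rfl
      · exact absurd rfl npp
      · exact .inl rfl
      · exact absurd hpq Q.nac
      · exact absurd hpq Q.nad
      · exact .inl (swap _ _)
      · exact absurd rfl npp
      · exact absurd hodd (Q.not_odd_middle T hpq)
      · exact absurd hpq Q.nbd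
      · exact absurd hpq.symm Q.nac
      · rw [swap] at hodd
        exact absurd hodd (Q.not_odd_middle T hpq.symm)
      · exact absurd rfl npp
      · exact .inr rfl
      · exact absurd hpq.symm Q.nad
      · exact absurd hpq.symm Q.nbd
      · exact .inr (swap _ _)
      · exact absurd rfl npp
    · rintro (rfl | rfl)
      · refine ⟨⟨is3Clique_iff.2 ⟨v, a, b, Q.va, Q.vb, Q.ab, rfl⟩, d, v, by simp, Q.vd.symm, ?_⟩,
          by simp⟩
        intro y hy hdy
        simp only [Finset.mem_insert, Finset.mem_singleton] at hy
        rcases hy with rfl | rfl | rfl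
        exacts [rfl, absurd hdy.symm Q.nad, absurd hdy.symm Q.nbd]
      · refine ⟨⟨is3Clique_iff.2 ⟨v, c, d, Q.vc, Q.vd, Q.cd, rfl⟩, a, v, by simp, Q.va.symm, ?_⟩,
          by simp⟩
        intro y hy hay
        simp only [Finset.mem_insert, Finset.mem_singleton] at hy
        rcases hy with rfl | rfl | rfl
        exacts [rfl, absurd hay Q.nac, absurd hay Q.nad]

/-- Counting incidences of nonisolated vertices with odd triangles gives two per vertex and three
per triangle. -/
theorem Tight.three_dvd (T : Tight G) : 3 ∣ (Finset.univ.filter fun v => 0 < G.degree v).card := by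
  classical
  set A := Finset.univ.filter fun v => 0 < G.degree v
  have h1 := Finset.sum_card_inter (s := A) (B := (G.cliqueFinset 3).filter (Odd G)) (n := 2)
    (fun v hv => by
      obtain ⟨a, b, c, d, Q⟩ := T.exists_quad (v := v) (by simpa [A] using hv)
      exact Q.card_odd_triangles T)
  have h2 : ∀ t ∈ (G.cliqueFinset 3).filter (Odd G), (A ∩ t).card = 3 := by
    intro t ht
    simp only [Finset.mem_filter, mem_cliqueFinset_iff] at ht
    rw [Finset.inter_eq_right.2, ht.1.card_eq]
    intro x hx
    obtain ⟨p, q, hp, -⟩ := exists_eq_of_isNClique ht.1 hx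
    simpa [A] using degree_pos_of_adj hp
  rw [Finset.sum_congr rfl h2, Finset.sum_const, smul_eq_mul] at h1
  omega

/-! ### Edge counts and the lower bound -/

theorem sum_degree_sub_four (A : Finset V) (hA : ∀ v, 0 < G.degree v → v ∈ A) :
    ∑ v ∈ A, ((G.degree v : ℤ) - 4) = 2 * (G.edgeSet.ncard : ℤ) - 4 * A.card := by
  classical
  have h3 := G.sum_degrees_eq_twice_card_edges
  rw [← Finset.sum_subset A.subset_univ (fun v _ hv => by
    by_contra hc
    exact hv (hA v (Nat.pos_of_ne_zero hc)))] at h3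
  rw [Finset.sum_sub_distrib, ← Nat.cast_sum, h3, ← coe_edgeFinset, Set.ncard_coe_finset]
  simp
  ring

theorem Sat.two_mul_card_support_le (h : Sat G)
    (hns : ∀ v, 0 < G.degree v → NonSimplicial G v) :
    2 * (Finset.univ.filter fun v => 0 < G.degree v).card ≤ G.edgeSet.ncard ∧
    (¬ 3 ∣ (Finset.univ.filter fun v => 0 < G.degree v).card →
      2 * (Finset.univ.filter fun v => 0 < G.degree v).card + 2 ≤ G.edgeSet.ncard) := by
  classical
  set A := Finset.univ.filter fun v => 0 < G.degree v with hAdef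
  have hmem : ∀ v, v ∈ A ↔ 0 < G.degree v := fun v => by simp [A]
  have hsum := sum_degree_sub_four A (fun v hv => (hmem v).2 hv)
  have hle := h.sum_weight_le A (fun z hz => (hmem z).2 (by have := hz.five_le h; omega))
  have hnn : ∀ v ∈ A, 0 ≤ weight G v := fun v hv => h.weight_nonneg (hns v ((hmem v).1 hv))
  have h0 := Finset.sum_nonneg hnn
  refine ⟨by omega, fun h3 => ?_⟩
  by_contra hc
  -- At most `2|A| + 1` edges leave a total excess of at most two, fewer than the three heavy
  -- vertices that a cubic vertex would bring.
  have hcard : ∑ v ∈ A, ((G.degree v : ℤ) - 4) ≤ 2 := by omega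
  apply h3
  by_cases hcubic : ∃ v, 0 < G.degree v ∧ G.degree v = 3
  · exfalso
    obtain ⟨v, hv, hd⟩ := hcubic
    obtain ⟨x, z, y, H⟩ := h.exists_hub (hns v hv) hd
    obtain ⟨a, b, c, hab, hac, hbc, wa, wb, wc⟩ := H.threeHeavy h
    have hin : ∀ {u}, 1 ≤ weight G u → u ∈ A := by
      intro u hu
      rw [hmem]
      by_contra h0
      have h1 : ¬ IsHub G u := fun hh => by have := hh.five_le h; omega
      have h2 : ¬ NonSimplicial G u := fun hh => by have := h.three_le_degree hh; omega
      have := weight_of_not_nonSimplicial h2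
      omega
    have hsub : ({a, b, c} : Finset V) ⊆ A := by
      intro u hu
      simp only [Finset.mem_insert, Finset.mem_singleton] at hu
      rcases hu with rfl | rfl | rfl
      exacts [hin wa, hin wb, hin wc]
    have := Finset.sum_le_sum_of_subset_of_nonneg hsub (fun v hv _ => hnn v hv)
    rw [Finset.sum_insert (by simp [hab, hac]), Finset.sum_pair hbc] at this
    omega
  · push Not at hcubic
    have hfour : ∀ v, 0 < G.degree v → 4 ≤ G.degree v := fun v hv => by
      have := h.three_le_degree (hns v hv)
      have := hcubic v hv
      omega
    refine Tight.three_dvd ⟨h, hns, hfour, fun S => ?_⟩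
    have h1 : ∑ v ∈ S, (G.degree v - 4) ≤ ∑ v, (G.degree v - 4) :=
      Finset.sum_le_sum_of_subset S.subset_univ
    have h2 : ∑ v ∈ A, (G.degree v - 4) = ∑ v, (G.degree v - 4) :=
      Finset.sum_subset A.subset_univ (fun v _ hv => by rw [hmem] at hv; omega)
    have h4 : ((∑ v ∈ A, (G.degree v - 4) : ℕ) : ℤ) = ∑ v ∈ A, ((G.degree v : ℤ) - 4) := by
      rw [Nat.cast_sum]
      refine Finset.sum_congr rfl fun v hv => ?_
      have := hfour v ((hmem v).1 hv)
      omega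
    omega

theorem Sat.lower_bound (h : Sat G) {n : ℕ} (hn : Fintype.card V = n) :
    (n % 3 ≠ 1 → 2 * n ≤ G.edgeSet.ncard) ∧ 2 * n - 2 ≤ G.edgeSet.ncard := by
  classical
  by_cases hpos : ∀ v, 0 < G.degree v
  · have := h.two_mul_card_le hpos
    omega
  push Not at hpos
  obtain ⟨v₀, hv₀⟩ := hpos
  have hiso : ∀ u, ¬ G.Adj v₀ u := fun u hu => by
    have := degree_pos_of_adj hu
    omega
  -- The isolated `v₀` is never a claw centre, so every other vertex is one when joined to it. The
  -- support therefore has size `n - 1`, a multiple of three exactly when `n % 3 = 1`.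
  have hns : ∀ u, u ≠ v₀ → NonSimplicial G u := by
    intro u hu
    rcases h.add v₀ u hu.symm (hiso u) with ⟨a, b, h1, -⟩ | ⟨a, b, h1, h2, h3, h4, -⟩
    · exact absurd h1 (hiso a)
    · exact ⟨a, b, h1, h2, h3, h4⟩
  have hA : (Finset.univ.filter fun v => 0 < G.degree v) = Finset.univ.erase v₀ := by
    ext u
    simp only [Finset.mem_filter, Finset.mem_univ, true_and, Finset.mem_erase, and_true]
    constructor
    · rintro hu rfl
      omega
    · intro hu
      obtain ⟨a, b, h1, -⟩ := hns u hu
      exact degree_pos_of_adj h1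
  obtain ⟨h1, h2⟩ := h.two_mul_card_support_le (fun v hv => hns v (by rintro rfl; omega))
  rw [hA, Finset.card_erase_of_mem (Finset.mem_univ _), Finset.card_univ, hn] at h1 h2
  have : 0 < n := hn ▸ Fintype.card_pos_iff.2 ⟨v₀⟩
  omega

end

end ClawSat

/-! ### Combining the bounds -/

theorem mainTheorem3 (n : ℕ) (hn : 9 ≤ n) (h14 : n ≠ 14) (h17 : n ≠ 17) :
    (∃ G : SimpleGraph (Fin n), IsInducedSaturated claw G) ∧
    (n % 3 = 0 → sis n claw = 2 * n) ∧
    (n % 3 = 1 → sis n claw = 2 * n - 2) ∧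
    (n % 3 = 2 → 2 * n ≤ sis n claw ∧ sis n claw ≤ 2 * n + 2) := by
  classical
  obtain ⟨e, ⟨G, hG, hGe⟩, he0, he1, he2⟩ : ∃ e,
      (∃ G : SimpleGraph (Fin n), ClawSat.Sat G ∧ G.edgeSet.ncard ≤ e) ∧
      (n % 3 = 0 → e = 2 * n) ∧ (n % 3 = 1 → e = 2 * n - 2) ∧ (n % 3 = 2 → e = 2 * n + 2) := by
    obtain h | h | h : n % 3 = 0 ∨ n % 3 = 1 ∨ n % 3 = 2 := by omega
    · obtain ⟨k, rfl⟩ : ∃ k, n = 3 * k := ⟨n / 3, by omega⟩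
      exact ⟨_, ClawSat.exists_sat_mul_three (by omega), by omega, by omega, by omega⟩
    · obtain ⟨k, rfl⟩ : ∃ k, n = 3 * k + 1 := ⟨n / 3, by omega⟩
      exact ⟨_, ClawSat.exists_sat_mul_three_add_one (by omega), by omega, by omega, by omega⟩
    · by_cases h11 : n = 11
      · subst h11
        exact ⟨_, ClawSat.exists_sat_eleven, by omega, by omega, by omega⟩
      -- The excluded values 14 and 17 correspond to `k = 1` and `k = 2`, too small for the
      -- three-point rows and columns of `cubicLine`.
      · obtain ⟨k, rfl⟩ : ∃ k, n = 3 * k + 11 := ⟨(n - 11) / 3, by omega⟩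
        exact ⟨_, ClawSat.exists_sat_mul_three_add_eleven (by omega), by omega, by omega,
          by omega⟩
  have hmem : G.edgeSet.ncard ∈ {m : ℕ | ∃ G : SimpleGraph (Fin n),
      IsInducedSaturated claw G ∧ G.edgeSet.ncard = m} := ⟨G, hG.isInducedSaturated, rfl⟩
  have hupper : sis n claw ≤ e := (Nat.sInf_le hmem).trans hGe
  obtain ⟨H, hH, hHe⟩ := Nat.sInf_mem ⟨_, hmem⟩
  have hlower := (ClawSat.Sat.of_isInducedSaturated hH).lower_bound (Fintype.card_fin n)
  rw [hHe] at hlower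
  change (n % 3 ≠ 1 → 2 * n ≤ sis n claw) ∧ 2 * n - 2 ≤ sis n claw at hlower
  exact ⟨⟨G, hG.isInducedSaturated⟩, by omega, by omega, by omega⟩
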